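/- Let $K$ be a field, let $\Delta$ be a simplicial complex on the vertex set $\{1,\dots,n\}$ such that every $\{i\}$ is a face, and let $I_\Delta\subseteq K[x_1,\dots,x_n]$ be its Stanley--Reisner ideal, generated by the monomials $\prod_{i\in S}x_i$ with $S\subseteq\{1,\dots,n\}$, $S\notin\Delta$. For $m\ge 0$ let $I_\Delta^{(m)}$ denote the $m$-th symbolic power of $I_\Delta$, that is, the intersection over the minimal primes $P$ of $I_\Delta$ of the $P$-primary components of $I_\Delta^m$ (the contractions to $K[x_1,\dots,x_n]$ of the localizations of $I_\Delta^m$ at $P$). Assume that $\Delta$ is pure (all facets have the same dimension) and two-dimensional. Then: (i) If $I_\Delta^{(m)}=I_\Delta^m$ for some $m\ge 3$, then $I_\Delta^{(k)}=I_\Delta^k$ for all $k\le m$. (ii) If $I_\Delta^{(m)}=I_\Delta^m$ for some $m\ge 4$, then $I_\Delta^{(k)}=I_\Delta^k$ for all $k\ge 1$. -/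

import Mathlib

/-- A facet of an abstract simplicial complex: a face that is maximal under inclusion. -/
def AbstractSimplicialComplex.IsFacet {V : Type*} (Δ : AbstractSimplicialComplex V)
    (F : Finset V) : Prop :=
  Maximal (fun G => G ∈ Δ.faces) F

/-- A complex is pure if all its facets have the same dimension. -/
def AbstractSimplicialComplex.IsPure {V : Type*} (Δ : AbstractSimplicialComplex V) : Prop :=
  ∀ F G : Finset V, Δ.IsFacet F → Δ.IsFacet G → F.card = G.card

/-- `Δ.HasDim d` says that `dim Δ = d`, i.e. that `d` is the maximal dimension of a face of `Δ`,
where the dimension of a face `F` is `F.card - 1`. -/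
def AbstractSimplicialComplex.HasDim {V : Type*} (Δ : AbstractSimplicialComplex V)
    (d : ℕ) : Prop :=
  (∃ F ∈ Δ.faces, F.card = d + 1) ∧ ∀ F ∈ Δ.faces, F.card ≤ d + 1

/-- The Stanley-Reisner ideal of `Δ` over `K`, generated by the squarefree monomials of the
nonfaces. Mathlib's complexes list only nonempty faces, whereas the empty set always counts as a
face of `Δ`; hence only nonempty `s` are used. -/
noncomputable def AbstractSimplicialComplex.stanleyReisnerIdeal {V : Type*}
    (Δ : AbstractSimplicialComplex V) (K : Type*) [Field K] : Ideal (MvPolynomial V K) :=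
  Ideal.span {f | ∃ s : Finset V, s.Nonempty ∧ s ∉ Δ.faces ∧
    f = ∏ i ∈ s, (MvPolynomial.X i : MvPolynomial V K)}

/-- The `m`-th symbolic power of an ideal `I`: the intersection of the primary components of
`I ^ m` at the minimal primes `p` of `I`, the `p`-primary component being the contraction of
`I ^ m` extended to the localization at `p`. -/
noncomputable def Ideal.symbolicPower {R : Type*} [CommRing R] (I : Ideal R) (m : ℕ) : Ideal R :=
  ⨅ (p : Ideal R) (hp : p ∈ I.minimalPrimes),
    haveI : p.IsPrime := hp.1.1
    ((I ^ m).map (algebraMap R (Localization.AtPrime p))).comap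
      (algebraMap R (Localization.AtPrime p))

/-! Both powers are monomial ideals, so their equality is a statement about exponent vectors `a`.
The monomial of `a` lies in the symbolic power when `a` has degree at least `k` outside every face
(`DegGE`), and in the ordinary power when `k` nonfaces, with repetition, fit under `a` (`Packs`).
The field disappears (`symbolicPower_eq_pow_iff`).

Necessary conditions come from padding. Adding `t` copies of a nonface raises the outside degree by
`t`, so a vector witnessing failure at a small power gives candidates at all larger powers. It
remains to see that these still do not pack, by counting degrees (`not_powersAgree_of_card`) or by
exchanging members of a packing (`not_powersAgree_of_pair`). For `m ≥ 4` this leaves at most six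
vertices. On six vertices the nonedges contain a perfect matching. On five, there are two disjoint
nonfaces, at least one of them a nonedge.

Sufficient conditions come from explicit packings. If the vertices split into three classes, each a
nonedge or a single vertex, with no three pairwise nonadjacent vertices
(`powersAgree_of_three_classes`), or into one such class and a nonface triple
(`powersAgree_of_class_of_triple`), then the powers agree for every `k`. One packs the classes as
far as possible and then packs the excess at the largest vertices; purity supplies triangles whose
degree conditions bound `k`. The complexes with at least four vertices that survive the necessary
conditions for `m ≥ 4` have one of these forms, or are the boundary of a tetrahedron. This gives
(ii). For (i) only the step from the third to the second power remains (`PowersAgree.two_of_three`).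
-/

namespace AbstractSimplicialComplex

open Finset

variable {V : Type*} {Δ : AbstractSimplicialComplex V}

/-! ### Conditions on exponent vectors. -/

/-- The nonempty nonfaces of a complex. -/
def IsNonface (Δ : AbstractSimplicialComplex V) (s : Finset V) : Prop :=
  s.Nonempty ∧ s ∉ Δ.faces

/-- The exponent vector `a` dominates the sum of the indicator vectors of `k` nonfaces. -/
def Packs [DecidableEq V] (Δ : AbstractSimplicialComplex V) (k : ℕ) (a : V → ℕ) : Prop :=
  ∃ M : Multiset (Finset V), M.card = k ∧ (∀ G ∈ M, Δ.IsNonface G) ∧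
    ∀ i, M.countP (i ∈ ·) ≤ a i

/-- The exponent vector `a` has degree at least `k` outside every face. -/
def DegGE [Fintype V] (Δ : AbstractSimplicialComplex V) (k : ℕ) (a : V → ℕ) : Prop :=
  ∀ F ∈ Δ.faces, k + ∑ i ∈ F, a i ≤ ∑ i, a i

/-- Every exponent vector in the `k`-th symbolic power is in the `k`-th ordinary power. -/
def PowersAgree [Fintype V] [DecidableEq V] (Δ : AbstractSimplicialComplex V) (k : ℕ) : Prop :=
  ∀ a : V → ℕ, Δ.DegGE k a → Δ.Packs k a

theorem mem_faces_of_subset {F G : Finset V} (hF : F ∈ Δ.faces) (h : G ⊆ F) (hG : G.Nonempty) :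
    G ∈ Δ.faces :=
  Δ.isRelLowerSet_faces.mem_of_le hF h hG

theorem IsNonface.not_subset {F G : Finset V} (hG : Δ.IsNonface G) (hF : F ∈ Δ.faces) :
    ¬ G ⊆ F := fun h => hG.2 (mem_faces_of_subset hF h hG.1)

theorem exists_isFacet_of_mem [Finite V] {F : Finset V} (hF : F ∈ Δ.faces) :
    ∃ T, Δ.IsFacet T ∧ F ⊆ T := by
  obtain ⟨T, h1, h2⟩ := (Set.toFinite {G | G ∈ Δ.faces}).exists_le_maximal hF
  exact ⟨T, h2, h1⟩

end AbstractSimplicialComplex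

/-! ### Face primes, described by the degree in the outside variables. -/

namespace MvPolynomial

open Finset

variable {V : Type*} [DecidableEq V] (K : Type*) [Field K]

/-- The ring homomorphism recording in the powers of a new variable the degree of a polynomial
in the variables outside `F`. -/
noncomputable def gradeOutside (F : Finset V) :
    MvPolynomial V K →ₐ[K] Polynomial (MvPolynomial V K) :=
  aeval fun i => if i ∈ F then Polynomial.C (X i) else Polynomial.C (X i) * Polynomial.X

/-- The prime ideal generated by the variables outside `F`. -/
noncomputable def primeOutside (F : Finset V) : Ideal (MvPolynomial V K) :=
  (Ideal.span {(Polynomial.X : Polynomial (MvPolynomial V K))}).comap (gradeOutside K F)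

variable {K}

theorem mem_primeOutside {F : Finset V} {f : MvPolynomial V K} :
    f ∈ primeOutside K F ↔ Polynomial.X ∣ gradeOutside K F f := by
  rw [primeOutside, Ideal.mem_comap, Ideal.mem_span_singleton]

/-- Defining the ideal as a pullback of `(X)` makes primality immediate; generation by variables is
recovered in `primeOutside_le`. -/
instance (F : Finset V) : (primeOutside K F).IsPrime := by
  have : (Ideal.span {(Polynomial.X : Polynomial (MvPolynomial V K))}).IsPrime := by
    rw [Ideal.span_singleton_prime Polynomial.X_ne_zero]
    exact Polynomial.prime_X
  exact Ideal.comap_isPrime _ _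

theorem gradeOutside_X (F : Finset V) (i : V) : gradeOutside K F (X i) =
    if i ∈ F then Polynomial.C (X i) else Polynomial.C (X i) * Polynomial.X := by
  simp [gradeOutside]

theorem gradeOutside_monomial [Fintype V] (F : Finset V) (a : V →₀ ℕ) (c : K) :
    gradeOutside K F (monomial a c) =
      Polynomial.C (monomial a c) * Polynomial.X ^ (∑ i ∈ Fᶜ, a i) := by
  have h : (∏ i, (if i ∈ F then Polynomial.C (X i) else
      Polynomial.C (X i) * Polynomial.X : Polynomial (MvPolynomial V K)) ^ a i) =
      (∏ i, Polynomial.C (X i) ^ a i) * Polynomial.X ^ (∑ i ∈ Fᶜ, a i) := by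
    have h1 : ∀ i, (if i ∈ F then Polynomial.C (X i) else
        Polynomial.C (X i) * Polynomial.X : Polynomial (MvPolynomial V K)) ^ a i =
        Polynomial.C (X i) ^ a i * (if i ∈ Fᶜ then Polynomial.X ^ a i else 1) := by
      intro i
      by_cases hi : i ∈ F <;> simp [hi, mul_pow]
    rw [Finset.prod_congr rfl fun i _ => h1 i, Finset.prod_mul_distrib, Finset.prod_ite_mem,
      Finset.univ_inter, Finset.prod_pow_eq_pow_sum]
  rw [gradeOutside, aeval_monomial, Finsupp.prod_fintype _ _ (by simp), h, ← mul_assoc]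
  congr 1
  rw [monomial_eq, Finsupp.prod_fintype _ _ (by simp)]
  simp only [map_mul, map_prod, map_pow]
  rfl

theorem coeff_gradeOutside [Fintype V] (F : Finset V) (f : MvPolynomial V K) (a : V →₀ ℕ) (d : ℕ) :
    coeff a ((gradeOutside K F f).coeff d) = if ∑ i ∈ Fᶜ, a i = d then coeff a f else 0 := by
  induction f using MvPolynomial.induction_on' with
  | monomial b c =>
    rw [gradeOutside_monomial, Polynomial.coeff_C_mul_X_pow]
    by_cases hb : b = a
    · subst hb
      by_cases hd : d = ∑ i ∈ Fᶜ, b i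
      · simp [hd]
      · simp [hd, Ne.symm hd]
    · split_ifs <;> simp [coeff_monomial, hb]
  | add p q hp hq =>
    rw [map_add, Polynomial.coeff_add, coeff_add, hp, hq, coeff_add]
    split_ifs <;> simp

theorem X_pow_dvd_gradeOutside [Fintype V] {F : Finset V} {f : MvPolynomial V K} {k : ℕ} :
    Polynomial.X ^ k ∣ gradeOutside K F f ↔ ∀ a ∈ f.support, k ≤ ∑ i ∈ Fᶜ, a i := by
  rw [Polynomial.X_pow_dvd_iff]
  constructor
  · intro h a ha
    by_contra! hlt
    have := coeff_gradeOutside F f a (∑ i ∈ Fᶜ, a i)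
    rw [h _ hlt, if_pos rfl, coeff_zero] at this
    exact mem_support_iff.mp ha this.symm
  · intro h d hd
    ext a
    rw [coeff_gradeOutside, coeff_zero]
    split_ifs with hs
    · by_contra hc
      have := h a (mem_support_iff.mpr hc)
      omega
    · rfl

theorem X_mem_primeOutside {F : Finset V} {i : V} :
    (X i : MvPolynomial V K) ∈ primeOutside K F ↔ i ∉ F := by
  rw [mem_primeOutside, gradeOutside_X, Polynomial.X_dvd_iff]
  by_cases hi : i ∈ F <;> simp [hi]

end MvPolynomial

/-! ### Symbolic and ordinary powers in terms of exponent vectors. -/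

namespace AbstractSimplicialComplex

open Finset MvPolynomial

variable {V : Type*} {Δ : AbstractSimplicialComplex V} {K : Type*} [Field K]

theorem prod_mem_stanleyReisnerIdeal {s : Finset V} (hs : Δ.IsNonface s) :
    ∏ i ∈ s, (X i : MvPolynomial V K) ∈ Δ.stanleyReisnerIdeal K :=
  Ideal.subset_span ⟨s, hs.1, hs.2, rfl⟩

variable [DecidableEq V]

theorem stanleyReisnerIdeal_le_primeOutside {F : Finset V} (hF : F ∈ Δ.faces) :
    Δ.stanleyReisnerIdeal K ≤ primeOutside K F := by
  refine Ideal.span_le.mpr ?_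
  rintro _ ⟨s, hs, hs', rfl⟩
  obtain ⟨i, hi, hiF⟩ := Finset.not_subset.mp (IsNonface.not_subset ⟨hs, hs'⟩ hF)
  exact Ideal.IsPrime.prod_mem_iff.mpr ⟨i, hi, X_mem_primeOutside.mpr hiF⟩

theorem isNonface_insert_of_isFacet {F : Finset V} (hF : Δ.IsFacet F) {i : V} (hi : i ∉ F) :
    Δ.IsNonface (insert i F) :=
  ⟨insert_nonempty _ _, fun h => hi (hF.2 h (subset_insert _ _) (mem_insert_self _ _))⟩

theorem primeOutside_le [Fintype V] {F : Finset V} {q : Ideal (MvPolynomial V K)}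
    (hX : ∀ i ∉ F, (X i : MvPolynomial V K) ∈ q) : primeOutside K F ≤ q := by
  intro f hf
  have hf' : f ∈ Ideal.span (X '' {i | i ∉ F} : Set (MvPolynomial V K)) := by
    rw [mem_ideal_span_X_image]
    intro a ha
    have h := mem_primeOutside.mp hf
    rw [← pow_one Polynomial.X, X_pow_dvd_gradeOutside] at h
    obtain ⟨i, hi, hia⟩ := Finset.exists_ne_zero_of_sum_ne_zero (Nat.one_le_iff_ne_zero.mp (h a ha))
    exact ⟨i, by simpa using hi, hia⟩
  refine Ideal.span_le.mpr ?_ hf'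
  rintro _ ⟨i, hi, rfl⟩
  exact hX i hi

theorem primeOutside_mem_minimalPrimes [Fintype V] {F : Finset V} (hF : Δ.IsFacet F) :
    primeOutside K F ∈ (Δ.stanleyReisnerIdeal K).minimalPrimes := by
  refine ⟨⟨inferInstance, stanleyReisnerIdeal_le_primeOutside hF.1⟩, ?_⟩
  rintro q ⟨hq, hIq⟩ hqF
  refine primeOutside_le fun i hi => ?_
  obtain ⟨j, hj, hjq⟩ := Ideal.IsPrime.prod_mem_iff.mp
    (hIq (prod_mem_stanleyReisnerIdeal (K := K) (isNonface_insert_of_isFacet hF hi)))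
  rcases mem_insert.mp hj with rfl | hj
  · exact hjq
  · exact absurd hj (X_mem_primeOutside.mp (hqF hjq))

/-- The variables outside `p` form a face, since a nonface monomial has a factor in `p`. The prime
of a facet containing that face lies in `p`, hence equals it by minimality. -/
theorem exists_isFacet_of_minimalPrimes [Fintype V] [Nonempty V] {p : Ideal (MvPolynomial V K)}
    (hp : p ∈ (Δ.stanleyReisnerIdeal K).minimalPrimes) :
    ∃ F, Δ.IsFacet F ∧ ∀ i ∈ F, (X i : MvPolynomial V K) ∉ p := by
  classical
  have : p.IsPrime := hp.1.1
  let S : Finset V := univ.filter fun i => (X i : MvPolynomial V K) ∉ p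
  obtain ⟨T, hT, hST⟩ : ∃ T, Δ.IsFacet T ∧ S ⊆ T := by
    by_cases hS : S.Nonempty
    · refine exists_isFacet_of_mem ?_
      by_contra hSf
      obtain ⟨i, hi, hip⟩ := Ideal.IsPrime.prod_mem_iff.mp
        (hp.1.2 (prod_mem_stanleyReisnerIdeal (K := K) (Δ := Δ) ⟨hS, hSf⟩))
      exact (mem_filter.mp hi).2 hip
    -- The empty set is not listed among the faces, so here any facet is taken.
    · obtain ⟨T, hT, -⟩ := exists_isFacet_of_mem (Δ.singleton_mem (Classical.arbitrary V))
      exact ⟨T, hT, by simp [Finset.not_nonempty_iff_eq_empty.mp hS]⟩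
  have hle : p ≤ primeOutside K T := by
    refine hp.2 ⟨inferInstance, stanleyReisnerIdeal_le_primeOutside hT.1⟩ (primeOutside_le ?_)
    intro i hi
    by_contra hip
    exact hi (hST (mem_filter.mpr ⟨mem_univ _, hip⟩))
  exact ⟨T, hT, fun i hi hip => X_mem_primeOutside.mp (hle hip) hi⟩

theorem mem_symbolicPower {R : Type*} [CommRing R] {I : Ideal R} {m : ℕ} {f : R} :
    f ∈ I.symbolicPower m ↔ ∀ p ∈ I.minimalPrimes, ∃ s ∉ p, s * f ∈ I ^ m := by
  unfold Ideal.symbolicPower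
  simp only [Ideal.mem_iInf]
  refine forall₂_congr fun p hp => ?_
  have : p.IsPrime := hp.1.1
  rw [Ideal.mem_comap, IsLocalization.algebraMap_mem_map_algebraMap_iff p.primeCompl]
  rfl

theorem mem_stanleyReisnerIdeal_pow [Fintype V] {m : ℕ} {f : MvPolynomial V K} :
    f ∈ Δ.stanleyReisnerIdeal K ^ m ↔ ∀ a ∈ f.support, Δ.Packs m a := by
  have hprod : ∀ s : Finset V, ∏ i ∈ s, (X i : MvPolynomial V K) =
      monomial (∑ i ∈ s, Finsupp.single i 1) 1 := by
    intro s
    rw [monomial_sum_one]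
    rfl
  have hspan : Δ.stanleyReisnerIdeal K ^ m = Ideal.span ((fun a => monomial a (1 : K)) ''
      {a | ∃ M : Multiset (Finset V), M.card = m ∧ (∀ G ∈ M, Δ.IsNonface G) ∧
        ∀ i, a i = M.countP (i ∈ ·)}) := by
    induction m with
    | zero =>
      rw [pow_zero, Ideal.one_eq_top, eq_comm, Ideal.eq_top_iff_one]
      exact Ideal.subset_span ⟨0, ⟨0, by simp⟩, by simp⟩
    | succ m ih =>
      rw [pow_succ, ih]
      conv_lhs => rw [stanleyReisnerIdeal]
      rw [Ideal.span_mul_span']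
      congr 1
      ext g
      rw [Set.mem_mul]
      constructor
      · rintro ⟨_, ⟨a, ⟨M, hM, hM', hMa⟩, rfl⟩, _, ⟨s, hs, hs', rfl⟩, rfl⟩
        refine ⟨a + ∑ i ∈ s, Finsupp.single i 1, ⟨s ::ₘ M, by simp [hM], ?_, ?_⟩, ?_⟩
        · intro G hG
          rcases Multiset.mem_cons.mp hG with rfl | hG
          exacts [⟨hs, hs'⟩, hM' _ hG]
        · intro i
          simp [Multiset.countP_cons, hMa, Finsupp.single_apply]
        · simp only [hprod, monomial_mul, mul_one]
      · rintro ⟨a, ⟨M, hM, hM', hMa⟩, rfl⟩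
        obtain ⟨s, hs⟩ := Multiset.card_pos_iff_exists_mem.mp (by omega : 0 < M.card)
        obtain ⟨N, rfl⟩ := Multiset.exists_cons_of_mem hs
        refine ⟨monomial (Finsupp.equivFunOnFinite.symm fun i => N.countP (i ∈ ·)) 1,
          ⟨_, ⟨N, by simpa using hM, fun G hG => hM' G (Multiset.mem_cons_of_mem hG),
            fun i => rfl⟩, rfl⟩, _, ⟨s, (hM' s hs).1, (hM' s hs).2, rfl⟩, ?_⟩
        rw [hprod, monomial_mul, mul_one]
        refine congrArg (fun b => monomial b (1 : K)) (Finsupp.ext fun i => ?_)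
        simp [Multiset.countP_cons, hMa, Finsupp.single_apply]
  rw [hspan, mem_ideal_span_monomial_image]
  refine forall₂_congr fun a _ => ⟨?_, ?_⟩
  · rintro ⟨b, ⟨M, hM, hM', hMb⟩, hb⟩
    exact ⟨M, hM, hM', fun i => (hMb i).symm.trans_le (hb i)⟩
  · rintro ⟨M, hM, hM', hMa⟩
    exact ⟨Finsupp.equivFunOnFinite.symm fun i => M.countP (i ∈ ·), ⟨M, hM, hM', fun i => rfl⟩,
      fun i => hMa i⟩

theorem monomial_mem_symbolicPower [Fintype V] [Nonempty V] {m : ℕ} {a : V →₀ ℕ}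
    (ha : Δ.DegGE m a) : monomial a (1 : K) ∈ (Δ.stanleyReisnerIdeal K).symbolicPower m := by
  rw [mem_symbolicPower]
  intro p hp
  have : p.IsPrime := hp.1.1
  obtain ⟨F, hF, hFp⟩ := exists_isFacet_of_minimalPrimes hp
  have hm : m ≤ ∑ i ∈ Fᶜ, a i := by
    have h1 := ha F hF.1
    have h2 := Finset.sum_add_sum_compl F a
    omega
  -- Each variable outside the facet `F`, counted with multiplicity, receives its own copy of the
  -- product over `F`; together they form the monomial of the nonface `insert i F`.
  refine ⟨(∏ i ∈ F, X i) ^ (∑ i ∈ Fᶜ, a i), fun h => ?_, Ideal.pow_le_pow_right hm ?_⟩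
  · obtain ⟨i, hi, hip⟩ := Ideal.IsPrime.prod_mem_iff.mp (this.mem_of_pow_mem _ h)
    exact hFp i hi hip
  · have h1 : monomial a (1 : K) = (∏ i ∈ F, X i ^ a i) * ∏ i ∈ Fᶜ, X i ^ a i := by
      rw [Finset.prod_mul_prod_compl, monomial_eq, Finsupp.prod_fintype _ _ (by simp), C_1, one_mul]
    have h2 : (∏ i ∈ F, X i) ^ (∑ i ∈ Fᶜ, a i) * monomial a (1 : K) =
        (∏ i ∈ F, X i ^ a i) * ∏ i ∈ Fᶜ, (X i * ∏ j ∈ F, X j) ^ a i := by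
      rw [h1, ← Finset.prod_pow_eq_pow_sum]
      simp only [mul_pow, Finset.prod_mul_distrib]
      ring
    rw [h2, ← Finset.prod_pow_eq_pow_sum]
    refine Ideal.mul_mem_left _ _ (Ideal.prod_mem_prod fun i hi => Ideal.pow_mem_pow ?_ _)
    have hi : i ∉ F := by simpa using hi
    rw [← Finset.prod_insert hi]
    exact prod_mem_stanleyReisnerIdeal (isNonface_insert_of_isFacet hF hi)

/-- The multiplier `s` avoids the prime of `F`, so its image is not divisible by the prime element
`X`; hence `X ^ m` divides the image of `f` itself. -/
theorem degGE_of_mem_symbolicPower [Fintype V] {m : ℕ} {f : MvPolynomial V K}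
    (hf : f ∈ (Δ.stanleyReisnerIdeal K).symbolicPower m) {a : V →₀ ℕ} (ha : a ∈ f.support) :
    Δ.DegGE m a := by
  intro G hG
  obtain ⟨F, hF, hGF⟩ := exists_isFacet_of_mem hG
  obtain ⟨s, hs, hsf⟩ := mem_symbolicPower.mp hf _ (primeOutside_mem_minimalPrimes hF)
  have h1 : Δ.stanleyReisnerIdeal K ^ m ≤
      (Ideal.span {(Polynomial.X : Polynomial (MvPolynomial V K)) ^ m}).comap
        (gradeOutside K F) := by
    rw [← Ideal.span_singleton_pow]
    exact (Ideal.pow_right_mono (stanleyReisnerIdeal_le_primeOutside hF.1) m).trans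
      (Ideal.le_comap_pow _ _)
  have h2 := h1 hsf
  rw [Ideal.mem_comap, Ideal.mem_span_singleton, map_mul] at h2
  have h3 := X_pow_dvd_gradeOutside.mp (Polynomial.prime_X.pow_dvd_of_dvd_mul_left m
    (fun h => hs (mem_primeOutside.mpr h)) h2) a ha
  have h4 := Finset.sum_add_sum_compl F a
  have h5 : ∑ i ∈ G, a i ≤ ∑ i ∈ F, a i := Finset.sum_le_sum_of_subset hGF
  omega

theorem symbolicPower_eq_pow_iff [Fintype V] [Nonempty V] (m : ℕ) :
    (Δ.stanleyReisnerIdeal K).symbolicPower m = Δ.stanleyReisnerIdeal K ^ m ↔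
      Δ.PowersAgree m := by
  constructor
  · intro h a ha
    have h1 := monomial_mem_symbolicPower (K := K) (Δ := Δ) (m := m)
      (a := Finsupp.equivFunOnFinite.symm a) ha
    rw [h, mem_stanleyReisnerIdeal_pow] at h1
    exact h1 (Finsupp.equivFunOnFinite.symm a) (by simp)
  · intro h
    refine le_antisymm (fun f hf => ?_) (fun f hf => ?_)
    · rw [mem_stanleyReisnerIdeal_pow]
      exact fun a ha => h a (degGE_of_mem_symbolicPower hf ha)
    · rw [mem_symbolicPower]
      exact fun p hp => ⟨1, fun h1 => hp.1.1.ne_top (p.eq_top_iff_one.mpr h1), by simpa using hf⟩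

end AbstractSimplicialComplex

/-! ### Packings and obstructions to agreement. -/

namespace AbstractSimplicialComplex

open Finset

variable {V : Type*} {Δ : AbstractSimplicialComplex V}

theorem IsNonface.two_le_card {G : Finset V} (hG : Δ.IsNonface G) : 2 ≤ G.card := by
  by_contra! h
  have h1 := hG.1.card_pos
  obtain ⟨v, rfl⟩ := card_eq_one.mp (show G.card = 1 by omega)
  exact hG.2 (Δ.singleton_mem v)

variable [DecidableEq V]

theorem Packs.mono {k : ℕ} {a b : V → ℕ} (h : Δ.Packs k a) (hab : ∀ i, a i ≤ b i) :
    Δ.Packs k b := by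
  obtain ⟨M, h1, h2, h3⟩ := h
  exact ⟨M, h1, h2, fun i => (h3 i).trans (hab i)⟩

theorem Packs.of_le {k l : ℕ} {a : V → ℕ} (h : Δ.Packs l a) (hkl : k ≤ l) : Δ.Packs k a := by
  induction hkl with
  | refl => exact h
  | step _ ih =>
    obtain ⟨M, h1, h2, h3⟩ := h
    obtain ⟨A, hA⟩ := Multiset.card_pos_iff_exists_mem.mp (show 0 < M.card by omega)
    obtain ⟨N, rfl⟩ := Multiset.exists_cons_of_mem hA
    exact ih ⟨N, by simpa using h1, fun G hG => h2 G (Multiset.mem_cons_of_mem hG),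
      fun i => (Multiset.countP_le_of_le _ (Multiset.le_cons_self _ _)).trans (h3 i)⟩

theorem packs_zero (a : V → ℕ) : Δ.Packs 0 a := ⟨0, by simp⟩

theorem Packs.add {k l : ℕ} {a b : V → ℕ} (ha : Δ.Packs k a) (hb : Δ.Packs l b) :
    Δ.Packs (k + l) (fun i => a i + b i) := by
  obtain ⟨M, h1, h2, h3⟩ := ha
  obtain ⟨N, h1', h2', h3'⟩ := hb
  refine ⟨M + N, by simp [h1, h1'], fun G hG => ?_, fun i => ?_⟩
  · rcases Multiset.mem_add.mp hG with hG | hG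
    exacts [h2 G hG, h2' G hG]
  · rw [Multiset.countP_add]
    exact add_le_add (h3 i) (h3' i)

theorem IsNonface.packs {G : Finset V} (hG : Δ.IsNonface G) (k : ℕ) :
    Δ.Packs k (fun i => if i ∈ G then k else 0) := by
  refine ⟨Multiset.replicate k G, by simp, fun A hA => ?_, fun i => ?_⟩
  · rwa [Multiset.eq_of_mem_replicate hA]
  · dsimp only
    split_ifs with h
    · exact (Multiset.countP_le_card _ _).trans (by simp)
    · rw [Nat.le_zero, Multiset.countP_eq_zero]
      intro A hA
      rwa [Multiset.eq_of_mem_replicate hA]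

theorem packs_two {A B : Finset V} {a : V → ℕ} (hA : Δ.IsNonface A) (hB : Δ.IsNonface B)
    (h : ∀ i, (if i ∈ A then 1 else 0) + (if i ∈ B then 1 else 0) ≤ a i) : Δ.Packs 2 a :=
  ((hA.packs 1).add (hB.packs 1)).mono h

theorem isNonface_pair {i j : V} (h : {i, j} ∉ Δ.faces) : Δ.IsNonface {i, j} :=
  ⟨by simp, h⟩

theorem ne_of_pair_notMem {i j : V} (h : {i, j} ∉ Δ.faces) : i ≠ j := by
  rintro rfl
  exact h (by simpa using Δ.singleton_mem i)

/-- A nonface in which all pairs are edges has at least three vertices. -/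
theorem IsNonface.three_le_card {G : Finset V} (hG : Δ.IsNonface G)
    (h : ∀ i ∈ G, ∀ j ∈ G, {i, j} ∈ Δ.faces) : 3 ≤ G.card := by
  by_contra! h'
  have h1 := hG.two_le_card
  obtain ⟨x, y, -, rfl⟩ := card_eq_two.mp (show G.card = 2 by omega)
  exact hG.2 (h x (by simp) y (by simp))

theorem exists_cons_of_countP {α : Type*} {p : α → Prop} [DecidablePred p] {M : Multiset α}
    (h : 0 < M.countP p) : ∃ A N, p A ∧ M = A ::ₘ N := by
  obtain ⟨A, hA, hp⟩ := Multiset.countP_pos.mp h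
  obtain ⟨N, hN⟩ := Multiset.exists_cons_of_mem hA
  exact ⟨A, N, hp, hN⟩

theorem one_le_of_mem {M : Multiset (Finset V)} {a : V → ℕ}
    (h : ∀ i, M.countP (i ∈ ·) ≤ a i) {G : Finset V} (hG : G ∈ M) {i : V} (hi : i ∈ G) :
    1 ≤ a i :=
  (Multiset.countP_pos.mpr ⟨G, hG, hi⟩ : 0 < M.countP (i ∈ ·)).trans_le (h i)

theorem sum_ite_mem_const (F G : Finset V) (t : ℕ) :
    ∑ i ∈ F, (if i ∈ G then t else 0) = (F ∩ G).card * t := by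
  rw [Finset.sum_ite_mem, Finset.sum_const, smul_eq_mul]

variable [Fintype V]

theorem sum_countP_mem (M : Multiset (Finset V)) :
    ∑ i, M.countP (i ∈ ·) = (M.map Finset.card).sum := by
  induction M using Multiset.induction_on with
  | empty => simp
  | cons A M ih =>
    simp only [Multiset.countP_cons, Finset.sum_add_distrib, ih, Multiset.map_cons,
      Multiset.sum_cons]
    simp [add_comm]

theorem card_mul_le_sum {M : Multiset (Finset V)} {a : V → ℕ} {s : ℕ}
    (h : ∀ i, M.countP (i ∈ ·) ≤ a i) (hs : ∀ G ∈ M, s ≤ G.card) : M.card * s ≤ ∑ i, a i := by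
  refine le_trans ?_ (Finset.sum_le_sum fun i _ => h i)
  rw [sum_countP_mem]
  have := Multiset.card_nsmul_le_sum (s := M.map Finset.card) (a := s) (by simpa using hs)
  simpa using this

/-- Every face misses a vertex of `G`, so each copy of `G` contributes at least one to the outside
degree. -/
theorem DegGE.add_nonface {k : ℕ} {a : V → ℕ} (ha : Δ.DegGE k a) {G : Finset V}
    (hG : Δ.IsNonface G) (t : ℕ) :
    Δ.DegGE (k + t) (fun i => a i + if i ∈ G then t else 0) := by
  intro F hF
  have h1 := ha F hF
  have h2 : (F ∩ G).card + 1 ≤ G.card := by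
    refine card_lt_card ⟨inter_subset_right, fun h => hG.not_subset hF ?_⟩
    exact h.trans inter_subset_left
  have h3 := Nat.mul_le_mul_right t h2
  rw [Finset.sum_add_distrib, Finset.sum_add_distrib, sum_ite_mem_const, sum_ite_mem_const,
    univ_inter]
  rw [add_mul, one_mul] at h3
  omega

/-- The indicator vector of `W` has degree at least `|W| - d` outside every face. -/
theorem degGE_indicator {W : Finset V} {d k : ℕ} (hd : ∀ F ∈ Δ.faces, (F ∩ W).card ≤ d)
    (hk : k + d ≤ W.card) : Δ.DegGE k (fun i => if i ∈ W then 1 else 0) := by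
  intro F hF
  have := hd F hF
  rw [sum_ite_mem_const, sum_ite_mem_const, univ_inter]
  omega

/-- Pad the indicator of `W` with `t` copies of a smallest nonface `G ⊆ W`. All members of a packing
lie in `W` and have at least `|G|` elements, so the padding pays for at most `t` of them, while
`|W|` is too small for the other `|W| - d`. -/
theorem not_powersAgree_of_card {W : Finset V} {s d : ℕ} (hW : Δ.IsNonface W)
    (hd : ∀ F ∈ Δ.faces, (F ∩ W).card ≤ d) (hs : ∀ A ⊆ W, Δ.IsNonface A → s ≤ A.card)
    (h : W.card < s * (W.card - d)) {m : ℕ} (hm : W.card ≤ m + d) : ¬ Δ.PowersAgree m := by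
  classical
  intro hgood
  obtain ⟨G, hG, hmin⟩ := (W.powerset.filter Δ.IsNonface).exists_min_image Finset.card
    ⟨W, by simp [hW]⟩
  simp only [mem_filter, mem_powerset] at hG hmin
  have hdW : d ≤ W.card := by
    by_contra! hlt
    rw [Nat.sub_eq_zero_of_le hlt.le] at h
    omega
  obtain ⟨t, rfl⟩ : ∃ t, m = W.card - d + t := ⟨m - (W.card - d), by omega⟩
  obtain ⟨M, hM, hM', hMa⟩ := hgood _
    ((degGE_indicator hd (k := W.card - d) (by omega)).add_nonface hG.2 t)
  have hsub : ∀ A ∈ M, A ⊆ W := by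
    intro A hA i hi
    have h1 := one_le_of_mem hMa hA hi
    by_contra hiW
    have hiG : i ∉ G := fun h => hiW (hG.1 h)
    simp [hiW, hiG] at h1
  have h2 := card_mul_le_sum hMa (s := G.card) fun A hA => hmin A ⟨hsub A hA, hM' A hA⟩
  rw [Finset.sum_add_distrib, sum_ite_mem_const, sum_ite_mem_const, univ_inter, univ_inter, hM,
    mul_one, add_mul, mul_comm t] at h2
  have h3 := Nat.mul_le_mul_right (W.card - d) (hs G hG.1 hG.2)
  have h4 := mul_comm G.card (W.card - d)
  omega

/-- Pad `a` with copies of `{i, j}`. From any packing of the result one extracts two nonfaces that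
fit under `a`: either `{i, j}` and one member, or a member avoiding `i` and another avoiding `j`. -/
theorem not_powersAgree_of_pair {a : V → ℕ} (ha : Δ.DegGE 2 a) (hp : ¬ Δ.Packs 2 a) {i j : V}
    (hij : {i, j} ∉ Δ.faces) (hi : 1 ≤ a i) (hj : 1 ≤ a j) {m : ℕ} (hm : 2 ≤ m) :
    ¬ Δ.PowersAgree m := by
  intro hgood
  have hne := ne_of_pair_notMem hij
  obtain ⟨t, rfl⟩ : ∃ t, m = 2 + t := ⟨m - 2, by omega⟩
  have hnf := isNonface_pair hij
  obtain ⟨M, hM, hM', hMa⟩ := hgood _ (ha.add_nonface hnf t)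
  have hsupp : ∀ A ∈ M, ∀ v ∈ A, 1 ≤ a v := by
    intro A hA v hv
    have h1 := one_le_of_mem hMa hA hv
    by_cases hvi : v = i
    · exact hvi ▸ hi
    · by_cases hvj : v = j
      · exact hvj ▸ hj
      · simpa [hvi, hvj] using h1
  -- Otherwise `A` and `{i, j}` together would fit under `a`.
  have hall : ∀ A ∈ M, (i ∉ A ∨ 2 ≤ a i) → (j ∉ A ∨ 2 ≤ a j) → False := by
    intro A hA h1 h2
    refine hp (packs_two hnf (hM' A hA) fun v => ?_)
    have := hsupp A hA v
    simp only [mem_insert, mem_singleton]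
    by_cases hvi : v = i
    · subst hvi; split_ifs <;> simp_all
    · by_cases hvj : v = j
      · subst hvj; split_ifs <;> simp_all
      · split_ifs <;> simp_all
  have hci := hMa i
  have hcj := hMa j
  simp only [mem_insert, mem_singleton, true_or, or_true, if_true] at hci hcj
  have hnot : ¬ (2 ≤ a i ∧ 2 ≤ a j) := by
    rintro ⟨h1, h2⟩
    obtain ⟨A, hA⟩ := Multiset.card_pos_iff_exists_mem.mp (show 0 < M.card by omega)
    exact hall A hA (Or.inr h1) (Or.inr h2)
  by_cases h1 : ∀ A ∈ M, i ∈ A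
  · have h2 : 2 ≤ a i := by
      rw [Multiset.countP_eq_card.mpr h1] at hci
      omega
    have h3 : ∀ A ∈ M, j ∈ A := fun A hA => by
      by_contra hjA
      exact hall A hA (Or.inr h2) (Or.inl hjA)
    rw [Multiset.countP_eq_card.mpr h3] at hcj
    omega
  · by_cases h1' : ∀ A ∈ M, j ∈ A
    · have h2 : 2 ≤ a j := by
        rw [Multiset.countP_eq_card.mpr h1'] at hcj
        omega
      have h3 : ∀ A ∈ M, i ∈ A := fun A hA => by
        by_contra hiA
        exact hall A hA (Or.inl hiA) (Or.inr h2)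
      exact h1 h3
    · push Not at h1 h1'
      obtain ⟨A, hA, hiA⟩ := h1
      obtain ⟨B, hB, hjB⟩ := h1'
      have hAB : A ≠ B := by
        rintro rfl
        exact hall A hA (Or.inl hiA) (Or.inl hjB)
      obtain ⟨N, rfl⟩ := Multiset.exists_cons_of_mem hA
      obtain ⟨N', rfl⟩ := Multiset.exists_cons_of_mem
        ((Multiset.mem_cons.mp hB).resolve_left hAB.symm)
      refine hp (packs_two (hM' A hA) (hM' B hB) fun v => ?_)
      have h3 := hMa v
      have hA' := hsupp A hA v
      have hB' := hsupp B hB v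
      simp only [Multiset.countP_cons] at h3
      by_cases hvi : v = i
      · subst hvi; rw [if_neg hiA]; split_ifs <;> simp_all
      · by_cases hvj : v = j
        · subst hvj; rw [if_neg hjB]; split_ifs <;> simp_all
        · simp only [mem_insert, mem_singleton, hvi, hvj, or_self, if_false] at h3
          omega

omit [DecidableEq V] in
theorem DegGE.isNonface_support [Nonempty V] {k : ℕ} {a : V → ℕ} (ha : Δ.DegGE k a)
    (hk : 1 ≤ k) : Δ.IsNonface (univ.filter fun i => 1 ≤ a i) := by
  have hsum : ∑ i, a i = ∑ i ∈ univ.filter fun i => 1 ≤ a i, a i := by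
    refine (Finset.sum_subset (subset_univ _) fun v _ hv => ?_).symm
    simp only [mem_filter, mem_univ, true_and] at hv
    omega
  refine ⟨?_, fun hf => ?_⟩
  · by_contra hne
    have := ha _ (Δ.singleton_mem (Classical.arbitrary V))
    rw [hsum, not_nonempty_iff_eq_empty.mp hne, sum_empty] at this
    omega
  · have := ha _ hf
    omega

theorem powersAgree_zero : Δ.PowersAgree 0 := fun a _ => packs_zero a

theorem powersAgree_one [Nonempty V] : Δ.PowersAgree 1 := fun a ha =>
  ((ha.isNonface_support le_rfl).packs 1).mono fun i => by
    simp only [mem_filter, mem_univ, true_and]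
    split_ifs <;> omega

/-- For a complex of dimension at most two, agreement of the third powers implies agreement of
the second powers. -/
theorem PowersAgree.two_of_three [Nonempty V] (hdim : ∀ F ∈ Δ.faces, F.card ≤ 3) (h3 : Δ.PowersAgree 3) :
    Δ.PowersAgree 2 := by
  classical
  intro a ha
  by_contra hp
  have hedge : ∀ i j, 1 ≤ a i → 1 ≤ a j → {i, j} ∈ Δ.faces := by
    intro i j hi hj
    by_contra hij
    exact not_powersAgree_of_pair ha hp hij hi hj (by norm_num) h3
  set W : Finset V := univ.filter fun i => 1 ≤ a i with hWdef
  have hmem : ∀ v, v ∈ W ↔ 1 ≤ a v := fun v => by simp [hWdef]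
  have hclique : ∀ A ⊆ W, Δ.IsNonface A → 3 ≤ A.card := fun A hA hA' =>
    hA'.three_le_card fun i hi j hj => hedge i j ((hmem i).mp (hA hi)) ((hmem j).mp (hA hj))
  have hWn : Δ.IsNonface W := ha.isNonface_support (by norm_num)
  -- Five pairwise adjacent vertices are excluded by the count `5 < 3 * (5 - 3)`.
  have hcard : W.card ≤ 4 := by
    by_contra! hlt
    obtain ⟨U, hU, hU5⟩ := exists_subset_card_eq (show 5 ≤ W.card by omega)
    refine not_powersAgree_of_card (W := U) (s := 3) (d := 3)
      ⟨card_pos.mp (by omega), fun h => by have := hdim U h; omega⟩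
      (fun F hF => (card_le_card inter_subset_left).trans (hdim F hF))
      (fun A hA => hclique A (hA.trans hU)) (by omega) (by omega) h3
  obtain ⟨G₀, hG₀, hmin⟩ := (W.powerset.filter Δ.IsNonface).exists_min_image Finset.card
    ⟨W, by simp [hWn]⟩
  -- `G` has the least size and, among nonfaces of that size, the largest weight under `a`. The
  -- weight serves to compare `a` at a vertex of `G` with `a` at the vertex of `W` outside `G`.
  obtain ⟨G, hG, hmax⟩ := ((W.powerset.filter Δ.IsNonface).filter
    fun A => A.card = G₀.card).exists_max_image (fun A => ∑ i ∈ A, a i)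
    ⟨G₀, mem_filter.mpr ⟨hG₀, rfl⟩⟩
  simp only [mem_filter, mem_powerset] at hG hmax hmin
  obtain ⟨⟨hGW, hGn⟩, hGc⟩ := hG
  have hG3 := hclique G hGW hGn
  obtain ⟨M, hM, hM', hMa⟩ := h3 _ (ha.add_nonface hGn 1)
  have hMW : ∀ A ∈ M, A ⊆ W := by
    intro A hA i hi
    have h1 := one_le_of_mem hMa hA hi
    rw [hmem]
    by_cases hiG : i ∈ G
    · exact (hmem i).mp (hGW hiG)
    · simpa [hiG] using h1
  -- Removing a member that contains `G` would undo the padding and leave two nonfaces under `a`.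
  have hnot : ∀ A ∈ M, ¬ G ⊆ A := by
    intro A hA hGA
    obtain ⟨N, rfl⟩ := Multiset.exists_cons_of_mem hA
    refine hp ⟨N, by simpa using hM, fun B hB => hM' B (Multiset.mem_cons_of_mem hB), fun i => ?_⟩
    have h1 := hMa i
    simp only [Multiset.countP_cons] at h1
    by_cases hi : i ∈ G
    · rw [if_pos (hGA hi), if_pos hi] at h1
      omega
    · rw [if_neg hi] at h1
      omega
  -- The contradiction is that two copies of `G` fit under `a`: every `x ∈ G` satisfies `2 ≤ a x`.
  refine hp ((hGn.packs 2).mono fun x => ?_)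
  split_ifs with hx
  swap
  · exact Nat.zero_le _
  have hxM := hMa x
  simp only [if_pos hx] at hxM
  by_cases hall : ∀ A ∈ M, x ∈ A
  · rw [Multiset.countP_eq_card.mpr hall, hM] at hxM
    omega
  push Not at hall
  obtain ⟨A, hA, hxA⟩ := hall
  -- `A` and `G` are three-element subsets of the four-element set `W`
  have hA3 := hclique A (hMW A hA) (hM' A hA)
  have hAx : A ⊆ W.erase x := fun v hv =>
    mem_erase.mpr ⟨fun h => hxA (h ▸ hv), hMW A hA hv⟩
  have hWx := card_erase_of_mem (hGW hx)
  have hAeq : A = W.erase x := eq_of_subset_of_card_le hAx (by omega)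
  have hGmin := hmin A ⟨hMW A hA, hM' A hA⟩
  have hAc : A.card = 3 := by
    have := card_le_card hAx
    omega
  rw [← hAeq, hAc] at hWx
  have hmaxA := hmax A ⟨⟨hMW A hA, hM' A hA⟩, by omega⟩
  have hpW : (W \ G).card = 1 := by
    rw [card_sdiff_of_subset hGW]
    omega
  obtain ⟨p, hp1⟩ := card_eq_one.mp hpW
  have hsumG := Finset.sum_sdiff (f := a) hGW
  rw [hp1, sum_singleton] at hsumG
  have hsumA := Finset.add_sum_erase W a (hGW hx)
  rw [← hAeq] at hsumA
  have hpG : p ∉ G := by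
    have : p ∈ W \ G := by rw [hp1]; simp
    exact (mem_sdiff.mp this).2
  -- `p` received no padding, so this gives `3 ≤ a p`; the maximal weight of `G` gives `a p ≤ a x`.
  have hpall : ∀ B ∈ M, p ∈ B := by
    intro B hB
    by_contra hpB
    have hBG : B ⊆ G := by
      intro v hv
      by_contra hvG
      have : v ∈ W \ G := mem_sdiff.mpr ⟨hMW B hB hv, hvG⟩
      rw [hp1, mem_singleton] at this
      exact hpB (this ▸ hv)
    have h1 := hmin B ⟨hMW B hB, hM' B hB⟩
    exact hnot B hB (eq_of_subset_of_card_le hBG (by omega)).ge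
  have hpM := hMa p
  simp only [Multiset.countP_eq_card.mpr hpall, if_neg hpG, hM] at hpM
  omega

/-! ### Perfect matchings by nonedges on six vertices. -/

/-- A graph on six vertices, given by its edges, in which every edge `i j` has two further edges
at `i` and two further edges at `j` with four distinct ends, has a perfect matching. -/
theorem exists_matching_of_double_stars (hV : Fintype.card V = 6) {N : V → V → Prop}
    (hsymm : ∀ x y, N x y → N y x) {i j : V} (hij : N i j) (hne : i ≠ j)
    (hN : ∀ i j, i ≠ j → N i j → ∃ p q r s, [i, j, p, q, r, s].Nodup ∧ N i p ∧ N i q ∧ N j r ∧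
      N j s) :
    ∃ u v w x y z, [u, v, w, x, y, z].Nodup ∧ N u v ∧ N w x ∧ N y z := by
  by_contra hno
  push Not at hno
  obtain ⟨p, q, r, s, hnd, hip, hiq, hjr, hjs⟩ := hN i j hne hij
  have hcover : ∀ v, v = i ∨ v = j ∨ v = p ∨ v = q ∨ v = r ∨ v = s := by
    intro v
    have h1 : ([i, j, p, q, r, s].toFinset : Finset V) = univ := by
      rw [← card_eq_iff_eq_univ, List.toFinset_card_of_nodup hnd, hV]
      rfl
    have h2 := mem_univ v
    rw [← h1] at h2
    simpa using h2
  have hnd' : [p, r, i, q, j, s].Nodup ∧ [p, s, i, q, j, r].Nodup ∧ [q, r, i, p, j, s].Nodup ∧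
      [q, s, i, p, j, r].Nodup := by
    clear hno hN hsymm hcover
    simp only [List.nodup_cons, List.mem_cons, List.not_mem_nil, not_or] at hnd ⊢
    grind
  -- An edge between `{p, q}` and `{r, s}` completes to a perfect matching with the remaining edges
  -- at `i` and `j`.
  have hpr : ¬ N p r := fun h => hno p r i q j s hnd'.1 h hiq hjs
  have hps : ¬ N p s := fun h => hno p s i q j r hnd'.2.1 h hiq hjr
  have hqr : ¬ N q r := fun h => hno q r i p j s hnd'.2.2.1 h hip hjs
  have hqs : ¬ N q s := fun h => hno q s i p j r hnd'.2.2.2 h hip hjr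
  have hnd2 := hnd
  simp only [List.nodup_cons, List.mem_cons, List.not_mem_nil, not_or] at hnd2
  -- The edge `x y` provides two distinct further neighbours of `y`; if only two candidates exist,
  -- both occur.
  have hends : ∀ {x y z : V}, x ≠ y → N x y → (∀ v, v ≠ x → v ≠ y → N y v → v = j ∨ v = z) ∨
      (∀ v, v ≠ x → v ≠ y → N y v → v = i ∨ v = z) → N y z := by
    intro x y z hxy hNxy h
    obtain ⟨_, _, u, v, hnd3, -, -, hu, hv⟩ := hN x y hxy hNxy
    have hd : u ≠ x ∧ u ≠ y ∧ v ≠ x ∧ v ≠ y ∧ u ≠ v := by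
      clear hno hN hsymm hcover h
      simp only [List.nodup_cons, List.mem_cons, List.not_mem_nil, not_or] at hnd3
      grind
    obtain ⟨h1, h2, h3, h4, h5⟩ := hd
    rcases h with h | h
    all_goals
      rcases h u h1 h2 hu with rfl | rfl
      · rcases h v h3 h4 hv with rfl | rfl
        exacts [absurd rfl h5, hv]
      · exact hu
  have hpq : N p q := by
    refine hends hnd2.1.2.1 hip (Or.inl fun v h1 h2 h3 => ?_)
    rcases hcover v with rfl | rfl | rfl | rfl | rfl | rfl
    exacts [absurd rfl h1, Or.inl rfl, absurd rfl h2, Or.inr rfl, absurd h3 hpr, absurd h3 hps]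
  have hrs : N r s := by
    refine hends hnd2.2.1.2.2.1 hjr (Or.inr fun v h1 h2 h3 => ?_)
    rcases hcover v with rfl | rfl | rfl | rfl | rfl | rfl
    exacts [Or.inl rfl, absurd rfl h1, absurd (hsymm _ _ h3) hpr, absurd (hsymm _ _ h3) hqr,
      absurd rfl h2, Or.inr rfl]
  exact hno i j p q r s hnd hij hpq hrs

/-- A packing of nonfaces into a vector of the least possible degree consists of nonedges and
uses up the whole vector. -/
theorem card_eq_two_of_sum_le {M : Multiset (Finset V)} {b : V → ℕ}
    (hM : ∀ A ∈ M, Δ.IsNonface A) (hb : ∀ i, M.countP (i ∈ ·) ≤ b i)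
    (hsum : ∑ i, b i ≤ 2 * M.card) : (∀ A ∈ M, A.card = 2) ∧ ∀ i, M.countP (i ∈ ·) = b i := by
  have hle : ∑ i, M.countP (i ∈ ·) ≤ ∑ i, b i := Finset.sum_le_sum fun i _ => hb i
  have hge : M.card * 2 ≤ ∑ i, M.countP (i ∈ ·) :=
    card_mul_le_sum (fun i => le_rfl) fun A hA => (hM A hA).two_le_card
  refine ⟨fun A hA => le_antisymm ?_ (hM A hA).two_le_card, fun i => ?_⟩
  · obtain ⟨N, rfl⟩ := Multiset.exists_cons_of_mem hA
    have hN : N.card * 2 ≤ ∑ i, N.countP (i ∈ ·) := card_mul_le_sum (fun i => le_rfl)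
      fun B hB => (hM B (Multiset.mem_cons_of_mem hB)).two_le_card
    rw [sum_countP_mem] at hN hle
    rw [Multiset.map_cons, Multiset.sum_cons] at hle
    rw [Multiset.card_cons] at hsum
    omega
  · exact (Finset.sum_eq_sum_iff_of_le fun i _ => hb i).mp (by omega) i (mem_univ i)

omit [Fintype V] in
theorem exists_eq_pair {A : Finset V} (hA : A.card = 2) {i : V} (hi : i ∈ A) :
    ∃ p, p ≠ i ∧ A = {i, p} := by
  obtain ⟨x, y, hxy, rfl⟩ := card_eq_two.mp hA
  rcases mem_insert.mp hi with rfl | hi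
  · exact ⟨y, hxy.symm, rfl⟩
  · rw [mem_singleton] at hi
    subst hi
    exact ⟨x, hxy, pair_comm _ _⟩

/-- If the `m`-th powers agree for some `m ≥ 3` on six vertices, then a nonedge `i j` extends to a
perfect matching by nonedges, or there are four distinct further vertices, two of them not
adjacent to `i` and two not adjacent to `j`. -/
theorem PowersAgree.matching_or_double_star (hV : Fintype.card V = 6)
    (hdim : ∀ F ∈ Δ.faces, F.card ≤ 3) {m : ℕ} (hm : 3 ≤ m) (hgood : Δ.PowersAgree m) {i j : V}
    (hij : {i, j} ∉ Δ.faces) :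
    (∃ u v w x y z, [u, v, w, x, y, z].Nodup ∧ {u, v} ∉ Δ.faces ∧ {w, x} ∉ Δ.faces ∧
      {y, z} ∉ Δ.faces) ∨
    ∃ p q r s, [i, j, p, q, r, s].Nodup ∧ {i, p} ∉ Δ.faces ∧ {i, q} ∉ Δ.faces ∧
      {j, r} ∉ Δ.faces ∧ {j, s} ∉ Δ.faces := by
  have hne := ne_of_pair_notMem hij
  obtain ⟨t, rfl⟩ : ∃ t, m = 3 + t := ⟨m - 3, by omega⟩
  have hτ : Δ.DegGE 3 (fun v => if v ∈ (univ : Finset V) then 1 else 0) :=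
    degGE_indicator (d := 3) (fun F hF => (card_le_card inter_subset_left).trans (hdim F hF))
      (by rw [card_univ, hV])
  obtain ⟨M, hM, hM', hMa⟩ := hgood _ (hτ.add_nonface (isNonface_pair hij) t)
  clear hτ hgood hm
  simp only [mem_univ, if_true, mem_insert, mem_singleton] at hMa
  -- The padded vector has degree `6 + 2 * t`, exactly twice the number of nonfaces packed.
  obtain ⟨hM2, hMeq⟩ := card_eq_two_of_sum_le hM' hMa (by
    rw [Finset.sum_add_distrib, Finset.sum_const, card_univ, hV]
    have h1 : ∑ v : V, (if v = i ∨ v = j then t else 0) = 2 * t := by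
      have := sum_ite_mem_const univ {i, j} t
      rw [univ_inter, card_pair hne] at this
      simpa using this
    rw [h1, hM]
    simp only [smul_eq_mul]
    omega)
  clear hMa
  induction t generalizing M with
  | zero =>
    left
    obtain ⟨A, B, C, rfl⟩ := Multiset.card_eq_three.mp hM
    obtain ⟨u, v, huv, rfl⟩ := card_eq_two.mp (hM2 A (by simp))
    obtain ⟨w, x, hwx, rfl⟩ := card_eq_two.mp (hM2 B (by simp))
    obtain ⟨y, z, hyz, rfl⟩ := card_eq_two.mp (hM2 C (by simp))
    refine ⟨u, v, w, x, y, z, ?_, (hM' _ (by simp)).2, (hM' _ (by simp)).2, (hM' _ (by simp)).2⟩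
    have hle : ∀ k, ¬ ((k = u ∨ k = v) ∧ (k = w ∨ k = x)) ∧
        ¬ ((k = u ∨ k = v) ∧ (k = y ∨ k = z)) ∧ ¬ ((k = w ∨ k = x) ∧ (k = y ∨ k = z)) := by
      intro k
      have := hMeq k
      simp only [Multiset.insert_eq_cons, ← Multiset.cons_zero, Multiset.countP_cons,
        Multiset.countP_zero, mem_insert, mem_singleton, ite_self, add_zero] at this
      refine ⟨?_, ?_, ?_⟩ <;> rintro ⟨h1, h2⟩ <;> rw [if_pos h1, if_pos h2] at this <;> omega
    have hu := hle u
    have hv := hle v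
    have hw := hle w
    have hx := hle x
    simp only [List.nodup_cons, List.mem_cons, List.not_mem_nil, not_or]
    clear hle hMeq hM2 hM' hM hdim hij hV
    grind
  | succ t ih =>
    by_cases hmem : {i, j} ∈ M
    · obtain ⟨N, rfl⟩ := Multiset.exists_cons_of_mem hmem
      refine ih N (by rw [Multiset.card_cons] at hM; omega) (fun A hA => hM' A (Multiset.mem_cons_of_mem hA))
        (fun A hA => hM2 A (Multiset.mem_cons_of_mem hA)) fun v => ?_
      have := hMeq v
      simp only [Multiset.countP_cons, mem_insert, mem_singleton] at this
      split_ifs at this ⊢ <;> omega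
    · right
      have hnot : ∀ A ∈ M, i ∈ A → j ∉ A := by
        intro A hA hi hj
        obtain ⟨p, -, rfl⟩ := exists_eq_pair (hM2 A hA) hi
        obtain rfl : j = p := by
          simpa [hne.symm] using hj
        exact hmem hA
      have hi := hMeq i
      have hj := hMeq j
      simp only [true_or, or_true, if_true] at hi hj
      -- At least two members contain `i` and at least two contain `j`, none containing both. Every
      -- other vertex is used once, so their other ends are distinct.
      obtain ⟨A, M, hiA, rfl⟩ := exists_cons_of_countP (hi.trans_gt (by omega))
      rw [Multiset.countP_cons, if_pos hiA] at hi
      obtain ⟨B, M, hiB, rfl⟩ := exists_cons_of_countP (p := (i ∈ ·)) (M := M) (by omega)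
      rw [Multiset.countP_cons, if_neg (hnot A (by simp) hiA), Multiset.countP_cons,
        if_neg (hnot B (by simp) hiB)] at hj
      obtain ⟨C, M, hjC, rfl⟩ := exists_cons_of_countP (p := (j ∈ ·)) (M := M) (by omega)
      rw [Multiset.countP_cons, if_pos hjC] at hj
      obtain ⟨D, M, hjD, rfl⟩ := exists_cons_of_countP (p := (j ∈ ·)) (M := M) (by omega)
      have hjA := hnot A (by simp) hiA
      have hjB := hnot B (by simp) hiB
      have hiC : i ∉ C := fun h => hnot C (by simp) h hjC
      have hiD : i ∉ D := fun h => hnot D (by simp) h hjD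
      obtain ⟨p, hp, rfl⟩ := exists_eq_pair (hM2 A (by simp)) hiA
      obtain ⟨q, hq, rfl⟩ := exists_eq_pair (hM2 B (by simp)) hiB
      obtain ⟨r, hr, rfl⟩ := exists_eq_pair (hM2 C (by simp)) hjC
      obtain ⟨s, hs, rfl⟩ := exists_eq_pair (hM2 D (by simp)) hjD
      refine ⟨p, q, r, s, ?_, (hM' _ (by simp)).2, (hM' _ (by simp)).2, (hM' _ (by simp)).2,
        (hM' _ (by simp)).2⟩
      have hle : ∀ k, k ≠ i → k ≠ j → (if k = p then 1 else 0) + (if k = q then 1 else 0) +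
          (if k = r then 1 else 0) + (if k = s then 1 else 0) ≤ 1 := by
        intro k hki hkj
        have := hMeq k
        simp only [Multiset.countP_cons, mem_insert, mem_singleton, hki, hkj, false_or,
          if_false, or_self] at this
        omega
      simp only [mem_insert, mem_singleton, not_or] at hjA hjB hiC hiD
      have h1 := hle p hp (Ne.symm hjA.2)
      have h2 := hle q hq (Ne.symm hjB.2)
      have h3 := hle r (Ne.symm hiC.2) hr
      simp only [List.nodup_cons, List.mem_cons, List.not_mem_nil, not_or]
      clear hle hMeq hM2 hM' hM hdim hij hV hnot hmem ih
      grind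

end AbstractSimplicialComplex

/-! ### Classes of nonadjacent vertices, and triangles supplied by purity. -/

namespace AbstractSimplicialComplex

open Finset

variable {V : Type*} [DecidableEq V] {Δ : AbstractSimplicialComplex V}

/-- `C` is a set of pairwise nonadjacent vertices, `x` is an element of `C` at which `a` is
largest, and `a` takes the value `e` at the other element of `C`, if there is one; if there is
none, then `e = 0`. -/
structure IsTop (Δ : AbstractSimplicialComplex V) (a : V → ℕ) (C : Finset V) (x : V) (e : ℕ) :
    Prop where
  mem : x ∈ C
  le : e ≤ a x
  sum_eq : ∑ v ∈ C, a v = a x + e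
  eq_of_ne : ∀ v ∈ C, v ≠ x → a v = e
  packs : Δ.Packs e (fun v => if v ∈ C then e else 0)
  nonedge : ∀ v ∈ C, ∀ w ∈ C, v ≠ w → {v, w} ∉ Δ.faces

theorem exists_isTop_singleton (Δ : AbstractSimplicialComplex V) (a : V → ℕ) (x : V) :
    ∃ x' e, Δ.IsTop a {x} x' e := by
  refine ⟨x, 0, by simp, Nat.zero_le _, by simp, ?_, packs_zero _, ?_⟩
  · intro v hv hne
    exact absurd (mem_singleton.mp hv) hne
  · intro v hv w hw hne
    rw [mem_singleton] at hv hw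
    exact absurd (hv.trans hw.symm) hne

theorem exists_isTop_pair (a : V → ℕ) {x y : V} (hxy : {x, y} ∉ Δ.faces) :
    ∃ x' e, Δ.IsTop a {x, y} x' e := by
  wlog h : a y ≤ a x generalizing x y
  · rw [pair_comm]
    exact this (by rwa [pair_comm]) (by omega)
  have hne := ne_of_pair_notMem hxy
  refine ⟨x, a y, by simp, h, sum_pair hne, ?_, (isNonface_pair hxy).packs _, ?_⟩
  · intro v hv hvx
    rw [mem_insert, mem_singleton] at hv
    rw [hv.resolve_left hvx]
  · intro v hv w hw hvw
    rw [mem_insert, mem_singleton] at hv hw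
    rcases hv with rfl | rfl <;> rcases hw with rfl | rfl
    exacts [absurd rfl hvw, hxy, by rwa [pair_comm], absurd rfl hvw]

/-- Every face of a pure two-dimensional complex lies in a face with three vertices. -/
def InTriangles (Δ : AbstractSimplicialComplex V) : Prop :=
  ∀ F ∈ Δ.faces, ∃ T ∈ Δ.faces, F ⊆ T ∧ T.card = 3

theorem InTriangles.exists_third (h : Δ.InTriangles) {x y : V} (hne : x ≠ y)
    (hxy : {x, y} ∈ Δ.faces) : ∃ w, w ≠ x ∧ w ≠ y ∧ {x, y, w} ∈ Δ.faces := by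
  obtain ⟨T, hT, hsub, hcard⟩ := h _ hxy
  obtain ⟨w, hw⟩ : (T \ {x, y}).Nonempty := by
    rw [← card_pos, card_sdiff_of_subset hsub, hcard, card_pair hne]
    norm_num
  simp only [mem_sdiff, mem_insert, mem_singleton, not_or] at hw
  refine ⟨w, hw.2.1, hw.2.2, mem_faces_of_subset hT ?_ (by simp)⟩
  simp only [insert_subset_iff, singleton_subset_iff] at hsub ⊢
  exact ⟨hsub.1, hsub.2, hw.1⟩

theorem InTriangles.exists_triangle (h : Δ.InTriangles) (x : V) :
    ∃ y z, y ≠ x ∧ z ≠ x ∧ z ≠ y ∧ {x, y, z} ∈ Δ.faces := by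
  obtain ⟨T, hT, hsub, hcard⟩ := h _ (Δ.singleton_mem x)
  obtain ⟨y, hy⟩ : (T \ {x}).Nonempty := by
    rw [← card_pos, card_sdiff_of_subset hsub, hcard, card_singleton]
    norm_num
  simp only [mem_sdiff, mem_singleton] at hy
  have hxy : {x, y} ∈ Δ.faces := mem_faces_of_subset hT
    (by simpa [insert_subset_iff, hy.1] using hsub) (by simp)
  obtain ⟨z, hzx, hzy, hz⟩ := h.exists_third (Ne.symm hy.2) hxy
  exact ⟨y, z, hy.2, hzx, hzy, hz⟩

theorem pairs_mem_of_triangle {x y z : V} (h : {x, y, z} ∈ Δ.faces) :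
    {x, y} ∈ Δ.faces ∧ {x, z} ∈ Δ.faces ∧ {y, z} ∈ Δ.faces := by
  refine ⟨?_, ?_, ?_⟩ <;> refine mem_faces_of_subset h ?_ (by simp) <;>
    simp [insert_subset_iff]

theorem IsTop.notMem_of_pair_mem {a : V → ℕ} {C : Finset V} {x v w : V} {e : ℕ}
    (h : Δ.IsTop a C x e) (hv : v ∈ C) (hne : v ≠ w) (hvw : {v, w} ∈ Δ.faces) : w ∉ C :=
  fun hw => h.nonedge v hv w hw hne hvw

variable [Fintype V]

theorem DegGE.triangle {k : ℕ} {a : V → ℕ} (ha : Δ.DegGE k a) {x y z : V} (hyx : y ≠ x)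
    (hzx : z ≠ x) (hzy : z ≠ y) (h : {x, y, z} ∈ Δ.faces) :
    k + (a x + a y + a z) ≤ ∑ v, a v := by
  have := ha _ h
  rw [sum_insert (by simp [hyx.symm, hzx.symm]), sum_pair hzy.symm] at this
  omega

/-! ### Explicit packings for three classes. -/

section Octahedron

variable {a : V → ℕ} {k : ℕ} {C₁ C₂ C₃ : Finset V} {x₁ x₂ x₃ : V} {e₁ e₂ e₃ : ℕ}

theorem sum_eq_of_isTop (h₁ : Δ.IsTop a C₁ x₁ e₁) (h₂ : Δ.IsTop a C₂ x₂ e₂)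
    (h₃ : Δ.IsTop a C₃ x₃ e₃) (hcover : ∀ v, v ∈ C₁ ∨ v ∈ C₂ ∨ v ∈ C₃)
    (h₁₂ : Disjoint C₁ C₂) (h₁₃ : Disjoint C₁ C₃) (h₂₃ : Disjoint C₂ C₃) :
    ∑ v, a v = a x₁ + e₁ + (a x₂ + e₂) + (a x₃ + e₃) := by
  have huniv : (univ : Finset V) = C₁ ∪ C₂ ∪ C₃ := by
    ext v
    simpa [or_assoc] using hcover v
  rw [huniv, sum_union (disjoint_union_left.mpr ⟨h₁₃, h₂₃⟩), sum_union h₁₂, h₁.sum_eq, h₂.sum_eq,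
    h₃.sum_eq]

omit [Fintype V] in
/-- A packing of the part of `a` that exceeds the three matched pairs can be completed. -/
theorem packs_of_isTop (h₁ : Δ.IsTop a C₁ x₁ e₁) (h₂ : Δ.IsTop a C₂ x₂ e₂)
    (h₃ : Δ.IsTop a C₃ x₃ e₃) (h₁₂ : Disjoint C₁ C₂) (h₁₃ : Disjoint C₁ C₃)
    (h₂₃ : Disjoint C₂ C₃) {r : ℕ} {g : V → ℕ}
    (hg : Δ.Packs r g) (hk : k ≤ e₁ + e₂ + e₃ + r)
    (hle : ∀ v, g v ≤ (if v = x₁ then a x₁ - e₁ else 0) + (if v = x₂ then a x₂ - e₂ else 0) +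
      (if v = x₃ then a x₃ - e₃ else 0)) : Δ.Packs k a := by
  refine ((((h₁.packs.add h₂.packs).add h₃.packs).add hg).mono fun v => ?_).of_le hk
  have hv := hle v
  have key : ∀ {C x e}, Δ.IsTop a C x e →
      (if v ∈ C then e else 0) + (if v = x then a x - e else 0) ≤ if v ∈ C then a v else 0 := by
    intro C x e h
    by_cases hvx : v = x
    · subst hvx
      have := h.le
      simp only [h.mem, if_true]
      omega
    · by_cases hvC : v ∈ C
      · simp [hvx, hvC, h.eq_of_ne v hvC hvx]
      · simp [hvx, hvC]
  have k₁ := key h₁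
  have k₂ := key h₂
  have k₃ := key h₃
  have hsum : (if v ∈ C₁ then a v else 0) + (if v ∈ C₂ then a v else 0) +
      (if v ∈ C₃ then a v else 0) ≤ a v := by
    have d₁ : v ∈ C₁ → v ∉ C₂ := fun h => disjoint_left.mp h₁₂ h
    have d₂ : v ∈ C₁ → v ∉ C₃ := fun h => disjoint_left.mp h₁₃ h
    have d₃ : v ∈ C₂ → v ∉ C₃ := fun h => disjoint_left.mp h₂₃ h
    by_cases c₁ : v ∈ C₁
    · simp [c₁, d₁ c₁, d₂ c₁]
    · by_cases c₂ : v ∈ C₂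
      · simp [c₁, c₂, d₃ c₂]
      · simp only [c₁, c₂, if_false]
        split_ifs <;> omega
  omega

/-- If the top vertices `x₁` and `x₂` are adjacent, then the three top vertices span a face or
the third top vertex can be exchanged. -/
theorem face_or_le_of_edge (hpure : Δ.InTriangles) (h₁ : Δ.IsTop a C₁ x₁ e₁)
    (h₂ : Δ.IsTop a C₂ x₂ e₂)
    (h₃ : Δ.IsTop a C₃ x₃ e₃) (hcover : ∀ v, v ∈ C₁ ∨ v ∈ C₂ ∨ v ∈ C₃)
    (h₁₂ : Disjoint C₁ C₂) (h₁₃ : Disjoint C₁ C₃) (h₂₃ : Disjoint C₂ C₃) (ha : Δ.DegGE k a)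
    (hedge : {x₁, x₂} ∈ Δ.faces) : {x₁, x₂, x₃} ∈ Δ.faces ∨ k ≤ e₁ + e₂ + a x₃ := by
  have hne : x₁ ≠ x₂ := fun h => disjoint_left.mp h₁₂ h₁.mem (h ▸ h₂.mem)
  obtain ⟨w, hw₁, hw₂, hw⟩ := hpure.exists_third hne hedge
  obtain ⟨-, hp₁, hp₂⟩ := pairs_mem_of_triangle hw
  -- `w` is adjacent to `x₁` and `x₂`, so it lies in neither of their classes.
  have hwC : w ∈ C₃ := ((hcover w).resolve_left
    (h₁.notMem_of_pair_mem h₁.mem hw₁.symm hp₁)).resolve_left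
    (h₂.notMem_of_pair_mem h₂.mem hw₂.symm hp₂)
  by_cases hwx : w = x₃
  · exact Or.inl (hwx ▸ hw)
  · right
    have := ha.triangle hne.symm hw₁ hw₂ hw
    rw [sum_eq_of_isTop h₁ h₂ h₃ hcover h₁₂ h₁₃ h₂₃, h₃.eq_of_ne w hwC hwx] at this
    omega

/-- After packing the classes, the excess is packed by nonedges at `x₁`. The edge `x₂ x₃` shows that
the excess at `x₁` suffices. The excess on the other side suffices by the edge `x₁ x₃`, or, if that
is missing, by a triangle at `x₁`, whose other vertices are not `x₂` or `x₃`. -/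
theorem packs_of_nonedge_of_edge (hpure : Δ.InTriangles) (h₁ : Δ.IsTop a C₁ x₁ e₁)
    (h₂ : Δ.IsTop a C₂ x₂ e₂)
    (h₃ : Δ.IsTop a C₃ x₃ e₃) (hcover : ∀ v, v ∈ C₁ ∨ v ∈ C₂ ∨ v ∈ C₃)
    (h₁₂ : Disjoint C₁ C₂) (h₁₃ : Disjoint C₁ C₃) (h₂₃ : Disjoint C₂ C₃) (ha : Δ.DegGE k a)
    (hn : {x₁, x₂} ∉ Δ.faces) (he : {x₂, x₃} ∈ Δ.faces) : Δ.Packs k a := by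
  have hne₁₂ : x₁ ≠ x₂ := fun h => disjoint_left.mp h₁₂ h₁.mem (h ▸ h₂.mem)
  have hne₁₃ : x₁ ≠ x₃ := fun h => disjoint_left.mp h₁₃ h₁.mem (h ▸ h₃.mem)
  have hne₂₃ : x₂ ≠ x₃ := fun h => disjoint_left.mp h₂₃ h₂.mem (h ▸ h₃.mem)
  have l₁ := h₁.le
  have l₂ := h₂.le
  have l₃ := h₃.le
  have b₁ : k ≤ e₂ + e₃ + a x₁ := by
    refine (face_or_le_of_edge hpure h₂ h₃ h₁ (fun v => by have := hcover v; tauto) h₂₃ h₁₂.symm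
      h₁₃.symm ha he).resolve_left fun h => ?_
    exact hn (pair_comm x₁ x₂ ▸ (pairs_mem_of_triangle h).2.1)
  by_cases he' : {x₁, x₃} ∈ Δ.faces
  · have b₂ : k ≤ e₁ + e₃ + a x₂ := by
      refine (face_or_le_of_edge hpure h₁ h₃ h₂ (fun v => by have := hcover v; tauto) h₁₃ h₁₂
        h₂₃.symm ha he').resolve_left fun h => ?_
      exact hn (pairs_mem_of_triangle h).2.1
    refine packs_of_isTop h₁ h₂ h₃ h₁₂ h₁₃ h₂₃
      ((isNonface_pair hn).packs (min (a x₁ - e₁) (a x₂ - e₂))) (by omega) fun v => ?_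
    simp only [mem_insert, mem_singleton]
    split_ifs <;> first | omega | (simp_all)
  · have b₂ : k ≤ e₁ + a x₂ + a x₃ := by
      obtain ⟨y, z, hyx, hzx, hzy, hf⟩ := hpure.exists_triangle x₁
      obtain ⟨p₁, p₂, p₃⟩ := pairs_mem_of_triangle hf
      have hy := (hcover y).resolve_left (h₁.notMem_of_pair_mem h₁.mem hyx.symm p₁)
      have hz := (hcover z).resolve_left (h₁.notMem_of_pair_mem h₁.mem hzx.symm p₂)
      have hsum := sum_eq_of_isTop h₁ h₂ h₃ hcover h₁₂ h₁₃ h₂₃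
      have ht := ha.triangle hyx hzx hzy hf
      have hx₂ : ∀ v, {x₁, v} ∈ Δ.faces → v ∈ C₂ → a v = e₂ := fun v hv hvC =>
        h₂.eq_of_ne v hvC fun h => hn (h ▸ hv)
      have hx₃ : ∀ v, {x₁, v} ∈ Δ.faces → v ∈ C₃ → a v = e₃ := fun v hv hvC =>
        h₃.eq_of_ne v hvC fun h => he' (h ▸ hv)
      rcases hy with hy | hy <;> rcases hz with hz | hz
      · exact absurd hz (h₂.notMem_of_pair_mem hy hzy.symm p₃)
      · rw [hx₂ y p₁ hy, hx₃ z p₂ hz] at ht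
        omega
      · rw [hx₃ y p₁ hy, hx₂ z p₂ hz] at ht
        omega
      · exact absurd hz (h₃.notMem_of_pair_mem hy hzy.symm p₃)
    refine packs_of_isTop h₁ h₂ h₃ h₁₂ h₁₃ h₂₃
      (((isNonface_pair hn).packs (min (a x₁ - e₁) (a x₂ - e₂))).add
        ((isNonface_pair he').packs (min (a x₁ - e₁ - min (a x₁ - e₁) (a x₂ - e₂)) (a x₃ - e₃))))
      (by omega) fun v => ?_
    simp only [mem_insert, mem_singleton]
    by_cases v₁ : v = x₁
    · subst v₁
      simp [hne₁₂, hne₁₃]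
      omega
    · by_cases v₂ : v = x₂
      · subst v₂
        simp [hne₁₂.symm, hne₂₃]
      · by_cases v₃ : v = x₃
        · subst v₃
          simp [hne₁₃.symm, hne₂₃.symm]
        · simp [v₁, v₂, v₃]

/-- If the top vertices span a face, its degree condition makes the class packing enough. Otherwise
the excess is packed by nonfaces inside `{x₁, x₂, x₃}`: the triple itself if all its pairs are
edges, nonedges if some are not. Three nonedges are ruled out by `hindep`. -/
theorem powersAgree_of_three_classes (hpure : Δ.InTriangles)
    (hC₁ : ∀ a, ∃ x e, Δ.IsTop a C₁ x e) (hC₂ : ∀ a, ∃ x e, Δ.IsTop a C₂ x e)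
    (hC₃ : ∀ a, ∃ x e, Δ.IsTop a C₃ x e) (hcover : ∀ v, v ∈ C₁ ∨ v ∈ C₂ ∨ v ∈ C₃)
    (h₁₂ : Disjoint C₁ C₂) (h₁₃ : Disjoint C₁ C₃) (h₂₃ : Disjoint C₂ C₃)
    (hindep : ∀ x y z, {x, y} ∉ Δ.faces → {x, z} ∉ Δ.faces → {y, z} ∈ Δ.faces) (k : ℕ) :
    Δ.PowersAgree k := by
  intro a ha
  obtain ⟨x₁, e₁, h₁⟩ := hC₁ a
  obtain ⟨x₂, e₂, h₂⟩ := hC₂ a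
  obtain ⟨x₃, e₃, h₃⟩ := hC₃ a
  have hne₁₂ : x₁ ≠ x₂ := fun h => disjoint_left.mp h₁₂ h₁.mem (h ▸ h₂.mem)
  have hne₁₃ : x₁ ≠ x₃ := fun h => disjoint_left.mp h₁₃ h₁.mem (h ▸ h₃.mem)
  have hne₂₃ : x₂ ≠ x₃ := fun h => disjoint_left.mp h₂₃ h₂.mem (h ▸ h₃.mem)
  have l₁ := h₁.le
  have l₂ := h₂.le
  have l₃ := h₃.le
  have c₁₃₂ : ∀ v, v ∈ C₁ ∨ v ∈ C₃ ∨ v ∈ C₂ := fun v => by have := hcover v; tauto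
  have c₂₃₁ : ∀ v, v ∈ C₂ ∨ v ∈ C₃ ∨ v ∈ C₁ := fun v => by have := hcover v; tauto
  have c₂₁₃ : ∀ v, v ∈ C₂ ∨ v ∈ C₁ ∨ v ∈ C₃ := fun v => by have := hcover v; tauto
  have c₃₁₂ : ∀ v, v ∈ C₃ ∨ v ∈ C₁ ∨ v ∈ C₂ := fun v => by have := hcover v; tauto
  have c₃₂₁ : ∀ v, v ∈ C₃ ∨ v ∈ C₂ ∨ v ∈ C₁ := fun v => by have := hcover v; tauto
  by_cases hT : {x₁, x₂, x₃} ∈ Δ.faces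
  · have ht := ha.triangle hne₁₂.symm hne₁₃.symm hne₂₃.symm hT
    rw [sum_eq_of_isTop h₁ h₂ h₃ hcover h₁₂ h₁₃ h₂₃] at ht
    exact packs_of_isTop h₁ h₂ h₃ h₁₂ h₁₃ h₂₃ (packs_zero 0) (by omega)
      fun v => Nat.zero_le _
  by_cases n₁₂ : {x₁, x₂} ∈ Δ.faces <;> by_cases n₁₃ : {x₁, x₃} ∈ Δ.faces <;>
    by_cases n₂₃ : {x₂, x₃} ∈ Δ.faces
  · have b₃ := (face_or_le_of_edge hpure h₁ h₂ h₃ hcover h₁₂ h₁₃ h₂₃ ha n₁₂).resolve_left hT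
    have b₂ := (face_or_le_of_edge hpure h₁ h₃ h₂ c₁₃₂ h₁₃ h₁₂ h₂₃.symm ha n₁₃).resolve_left
      (by rwa [pair_comm x₃ x₂])
    have b₁ := (face_or_le_of_edge hpure h₂ h₃ h₁ c₂₃₁ h₂₃ h₁₂.symm h₁₃.symm ha
      n₂₃).resolve_left (by rwa [pair_comm x₃ x₁, Finset.insert_comm])
    have hTn : Δ.IsNonface {x₁, x₂, x₃} := ⟨by simp, hT⟩
    refine packs_of_isTop h₁ h₂ h₃ h₁₂ h₁₃ h₂₃ (hTn.packs
      (min (a x₁ - e₁) (min (a x₂ - e₂) (a x₃ - e₃)))) (by omega) fun v => ?_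
    simp only [mem_insert, mem_singleton]
    split_ifs <;> first | omega | (simp_all)
  · exact packs_of_nonedge_of_edge hpure h₃ h₂ h₁ c₃₂₁ h₂₃.symm h₁₃.symm h₁₂.symm ha
      (by rwa [pair_comm]) (by rwa [pair_comm])
  · exact packs_of_nonedge_of_edge hpure h₃ h₁ h₂ c₃₁₂ h₁₃.symm h₂₃.symm h₁₂ ha
      (by rwa [pair_comm]) n₁₂
  · exact packs_of_nonedge_of_edge hpure h₃ h₁ h₂ c₃₁₂ h₁₃.symm h₂₃.symm h₁₂ ha
      (by rwa [pair_comm]) n₁₂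
  · exact packs_of_nonedge_of_edge hpure h₁ h₂ h₃ hcover h₁₂ h₁₃ h₂₃ ha n₁₂ n₂₃
  · exact packs_of_nonedge_of_edge hpure h₂ h₁ h₃ c₂₁₃ h₁₂.symm h₂₃ h₁₃ ha
      (by rwa [pair_comm]) n₁₃
  · exact packs_of_nonedge_of_edge hpure h₁ h₂ h₃ hcover h₁₂ h₁₃ h₂₃ ha n₁₂ n₂₃
  · exact absurd (hindep x₁ x₂ x₃ n₁₂ n₁₃) n₂₃

end Octahedron

/-! ### Explicit packings for one class and a nonface triple. -/

section Suspension

variable {a : V → ℕ} {k : ℕ} {C : Finset V} {u x y z : V} {e : ℕ}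

omit [Fintype V] in
/-- A packing of the part of `a` that exceeds the matched pair of `C` and the nonfaces `x y z`
can be completed. -/
theorem packs_of_isTop_of_triple (hC : Δ.IsTop a C u e) (hx : x ∉ C) (hy : y ∉ C) (hz : z ∉ C)
    (hxy : x ≠ y) (hxz : x ≠ z) (hyz : y ≠ z) (hn : {x, y, z} ∉ Δ.faces) (hzy : a z ≤ a y)
    (hyx : a y ≤ a x) {r : ℕ} {g : V → ℕ} (hg : Δ.Packs r g) (hk : k ≤ e + a z + r)
    (hle : ∀ v, g v ≤ (if v = u then a u - e else 0) + (if v = x then a x - a z else 0) +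
      (if v = y then a y - a z else 0)) : Δ.Packs k a := by
  have hxyz : Δ.IsNonface {x, y, z} := ⟨by simp, hn⟩
  refine (((hC.packs.add (hxyz.packs (a z))).add hg).mono fun v => ?_).of_le hk
  have hv := hle v
  have hux : u ≠ x := fun h => hx (h ▸ hC.mem)
  have huy : u ≠ y := fun h => hy (h ▸ hC.mem)
  have huz : u ≠ z := fun h => hz (h ▸ hC.mem)
  have hl := hC.le
  simp only [mem_insert, mem_singleton]
  by_cases hvC : v ∈ C
  · have hvx : v ≠ x := fun h => hx (h ▸ hvC)
    have hvy : v ≠ y := fun h => hy (h ▸ hvC)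
    have hvz : v ≠ z := fun h => hz (h ▸ hvC)
    by_cases hvu : v = u
    · subst hvu
      simp only [hvx, hvy, hvz, hvC, or_self, if_true, if_false] at hv ⊢
      omega
    · have := hC.eq_of_ne v hvC hvu
      simp only [hvx, hvy, hvz, hvC, hvu, or_self, if_true, if_false] at hv ⊢
      omega
  · have hvu : v ≠ u := fun h => hvC (h ▸ hC.mem)
    by_cases hvx : v = x
    · subst hvx
      simp only [hvu, hvC, hxy, true_or, if_true, if_false] at hv ⊢
      omega
    · by_cases hvy : v = y
      · subst hvy
        simp only [hvu, hvC, hvx, true_or, or_true, if_true, if_false] at hv ⊢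
        omega
      · by_cases hvz : v = z
        · subst hvz
          simp only [hvu, hvC, hvx, hvy, or_true, if_true, if_false] at hv ⊢
          omega
        · simp only [hvu, hvC, hvx, hvy, hvz, or_self, if_false] at hv ⊢
          omega

/-- Packing the class `e` times and the triple `a z` times leaves an excess only at `u`, `x` and
`y`. The rest is packed by nonfaces inside `{u, x, y}`, with `k` bounded by the triangles available.
-/
theorem packs_of_triple_of_sorted (hpure : Δ.InTriangles) (hC : Δ.IsTop a C u e) (hx : x ∉ C)
    (hy : y ∉ C) (hz : z ∉ C) (hxy : x ≠ y) (hxz : x ≠ z) (hyz : y ≠ z)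
    (hcover : ∀ v, v ∈ C ∨ v = x ∨ v = y ∨ v = z) (hn : {x, y, z} ∉ Δ.faces) (hzy : a z ≤ a y)
    (hyx : a y ≤ a x) (ha : Δ.DegGE k a) : Δ.Packs k a := by
  have hux : u ≠ x := fun h => hx (h ▸ hC.mem)
  have huy : u ≠ y := fun h => hy (h ▸ hC.mem)
  have huz : u ≠ z := fun h => hz (h ▸ hC.mem)
  have hl := hC.le
  have hsum : ∑ v, a v = a u + e + (a x + a y + a z) := by
    have huniv : (univ : Finset V) = C ∪ {x, y, z} := by
      ext v
      have := hcover v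
      simp only [mem_univ, mem_union, mem_insert, mem_singleton, true_iff]
      exact this
    rw [huniv, sum_union (by simp [hx, hy, hz]), hC.sum_eq, sum_insert (by simp [hxy, hxz]),
      sum_pair hyz]
    ring
  have finish : ∀ {r : ℕ} {g : V → ℕ}, Δ.Packs r g → k ≤ e + a z + r →
      (∀ v, g v ≤ (if v = u then a u - e else 0) + (if v = x then a x - a z else 0) +
        (if v = y then a y - a z else 0)) → Δ.Packs k a :=
    packs_of_isTop_of_triple hC hx hy hz hxy hxz hyz hn hzy hyx
  have b_uxy : {u, x, y} ∈ Δ.faces → k ≤ e + a z := fun h => by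
    have := ha.triangle hux.symm huy.symm hxy.symm h
    omega
  have b_uxz : {u, x, z} ∈ Δ.faces → k ≤ e + a y := fun h => by
    have := ha.triangle hux.symm huz.symm hxz.symm h
    omega
  have b_uyz : {u, y, z} ∈ Δ.faces → k ≤ e + a x := fun h => by
    have := ha.triangle huy.symm huz.symm hyz.symm h
    omega
  have hthird : ∀ w, w ≠ u → {u, w} ∈ Δ.faces → w = x ∨ w = y ∨ w = z := fun w hw h =>
    (hcover w).resolve_left (hC.notMem_of_pair_mem hC.mem hw.symm h)
  -- the triangles at `u`
  have htri : {u, x, y} ∈ Δ.faces ∨ {u, x, z} ∈ Δ.faces ∨ {u, y, z} ∈ Δ.faces := by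
    obtain ⟨p, q, hp, hq, hqp, hf⟩ := hpure.exists_triangle u
    obtain ⟨p₁, p₂, -⟩ := pairs_mem_of_triangle hf
    have hf' : {u, q, p} ∈ Δ.faces := by rwa [pair_comm q p]
    rcases hthird p hp p₁ with rfl | rfl | rfl <;> rcases hthird q hq p₂ with rfl | rfl | rfl <;>
      tauto
  by_cases h_uxy : {u, x, y} ∈ Δ.faces
  · exact finish (packs_zero 0) (by have := b_uxy h_uxy; omega) fun v => Nat.zero_le _
  by_cases h_xy : {x, y} ∈ Δ.faces
  -- The third vertex of a triangle on `x y` is neither `z` nor `u`, so it lies in `C`, where `a`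
  -- equals `e`.
  · have b_xy : k ≤ a u + a z := by
      obtain ⟨w, hwx, hwy, hw⟩ := hpure.exists_third hxy h_xy
      have hwu : w ≠ u := by
        rintro rfl
        apply h_uxy
        rwa [Finset.insert_comm, pair_comm w y]
      have hwC : w ∈ C := by
        rcases hcover w with h | h | h | h
        exacts [h, absurd h hwx, absurd h hwy, absurd (h ▸ hw) hn]
      have := ha.triangle hxy.symm hwx hwy hw
      rw [hC.eq_of_ne w hwC hwu] at this
      omega
    by_cases h_ux : {u, x} ∈ Δ.faces
    · have b₁ : k ≤ e + a y := by
        obtain ⟨w, hwu, hwx, hw⟩ := hpure.exists_third hux h_ux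
        rcases hthird w hwu (pairs_mem_of_triangle hw).2.1 with rfl | rfl | rfl
        exacts [absurd rfl hwx, absurd hw h_uxy, b_uxz hw]
      by_cases h_uy : {u, y} ∈ Δ.faces
      · have hnf : Δ.IsNonface {u, x, y} := ⟨by simp, h_uxy⟩
        refine finish (hnf.packs (min (a u - e) (a y - a z))) (by omega) fun v => ?_
        simp only [mem_insert, mem_singleton]
        split_ifs <;> first | omega | simp_all
      · refine finish ((isNonface_pair h_uy).packs (min (a u - e) (a y - a z))) (by omega)
          fun v => ?_
        simp only [mem_insert, mem_singleton]
        split_ifs <;> first | omega | simp_all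
    · have b₁ : k ≤ e + a x := by
        rcases htri with h | h | h
        exacts [absurd h h_uxy, absurd (pairs_mem_of_triangle h).1 h_ux, b_uyz h]
      refine finish ((isNonface_pair h_ux).packs (min (a u - e) (a x - a z))) (by omega)
        fun v => ?_
      simp only [mem_insert, mem_singleton]
      split_ifs <;> first | omega | simp_all
  · by_cases h_uxz : {u, x, z} ∈ Δ.faces
    · have b₁ := b_uxz h_uxz
      refine finish ((isNonface_pair h_xy).packs (a y - a z)) (by omega) fun v => ?_
      simp only [mem_insert, mem_singleton]
      split_ifs <;> first | omega | simp_all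
    · have b₁ : k ≤ e + a x := b_uyz ((htri.resolve_left h_uxy).resolve_left h_uxz)
      have h_ux : {u, x} ∉ Δ.faces := fun h => by
        obtain ⟨w, hwu, hwx, hw⟩ := hpure.exists_third hux h
        rcases hthird w hwu (pairs_mem_of_triangle hw).2.1 with rfl | rfl | rfl
        exacts [hwx rfl, h_uxy hw, h_uxz hw]
      have b₂ : k ≤ a u + a y := by
        obtain ⟨p, q, hp, hq, hqp, hf⟩ := hpure.exists_triangle x
        obtain ⟨p₁, p₂, p₃⟩ := pairs_mem_of_triangle hf
        have ht := ha.triangle hp hq hqp hf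
        have hside : ∀ w, w ≠ x → {x, w} ∈ Δ.faces → w ∈ C ∧ a w = e ∨ w = z := by
          intro w hw h
          rcases hcover w with h' | h' | h' | h'
          · refine Or.inl ⟨h', hC.eq_of_ne w h' ?_⟩
            rintro rfl
            exact h_ux (by rwa [pair_comm])
          · exact absurd h' hw
          · exact absurd (h' ▸ h) h_xy
          · exact Or.inr h'
        rcases hside p hp p₁ with ⟨c₁, v₁⟩ | rfl <;> rcases hside q hq p₂ with ⟨c₂, v₂⟩ | rfl
        · exact absurd c₂ (hC.notMem_of_pair_mem c₁ hqp.symm p₃)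
        · omega
        · omega
        · exact absurd rfl hqp
      -- The nonedge `x y` exhausts the excess at `y`; what is left at `x` is paired with `u`.
      refine finish (((isNonface_pair h_xy).packs (a y - a z)).add
        ((isNonface_pair h_ux).packs (min (a x - a y) (a u - e)))) (by omega) fun v => ?_
      simp only [mem_insert, mem_singleton]
      by_cases v₁ : v = u
      · subst v₁
        simp [hux, huy]
      · by_cases v₂ : v = x
        · subst v₂
          simp [hux.symm, hxy]
          omega
        · by_cases v₃ : v = y
          · subst v₃
            simp [huy.symm, hxy.symm]
          · simp [v₁, v₂, v₃]

theorem powersAgree_of_class_of_triple (hpure : Δ.InTriangles)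
    (hC : ∀ a, ∃ u e, Δ.IsTop a C u e) {S : Finset V} (hS : S.card = 3) (hSn : S ∉ Δ.faces)
    (hCS : Disjoint C S) (hcover : ∀ v, v ∈ C ∨ v ∈ S) (k : ℕ) : Δ.PowersAgree k := by
  intro a ha
  obtain ⟨u, e, hu⟩ := hC a
  obtain ⟨x, hx, hxmax⟩ := S.exists_max_image a (card_pos.mp (by omega))
  have hcx := card_erase_of_mem hx
  obtain ⟨y, hy, hymax⟩ := (S.erase x).exists_max_image a (card_pos.mp (by omega))
  have hcy := card_erase_of_mem hy
  obtain ⟨z, hz⟩ := card_eq_one.mp (show ((S.erase x).erase y).card = 1 by omega)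
  have hz' : z ∈ (S.erase x).erase y := by rw [hz]; simp
  simp only [mem_erase] at hy hz' hymax
  obtain rfl : {x, y, z} = S := by
    rw [← hz, insert_erase (by simp [hy]), insert_erase hx]
  have hdis : ∀ v ∈ ({x, y, z} : Finset V), v ∉ C := fun v hv hvC => disjoint_left.mp hCS hvC hv
  exact packs_of_triple_of_sorted hpure hu (hdis x (by simp)) (hdis y (by simp))
    (hdis z (by simp)) hy.1.symm hz'.2.1.symm hz'.1.symm (fun v => by simpa using hcover v)
    hSn (hymax z ⟨hz'.2.1, hz'.2.2⟩) (hxmax y hy.2) ha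

end Suspension

end AbstractSimplicialComplex

/-! ### Cases by the number of vertices. -/

namespace AbstractSimplicialComplex

open Finset

variable {V : Type*} [DecidableEq V] {Δ : AbstractSimplicialComplex V} [Fintype V]

/-- Seven vertices violate the count, as `7 < 2 * (7 - 3)`; the obstruction starts at the power `7 -
3 = 4`. -/
theorem PowersAgree.card_le_six (hdim : ∀ F ∈ Δ.faces, F.card ≤ 3) {m : ℕ} (hm : 4 ≤ m)
    (hgood : Δ.PowersAgree m) : Fintype.card V ≤ 6 := by
  by_contra! hlt
  obtain ⟨W, -, hW⟩ := exists_subset_card_eq (s := (univ : Finset V)) (n := 7)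
    (by rw [card_univ]; omega)
  exact not_powersAgree_of_card (W := W) (s := 2) (d := 3)
    ⟨card_pos.mp (by omega), fun h => by have := hdim W h; omega⟩
    (fun F hF => (card_le_card inter_subset_left).trans (hdim F hF))
    (fun A _ hA => hA.two_le_card) (by omega) (by omega) hgood

/-- A face meets three pairwise nonadjacent vertices in at most one, and `3 < 2 * (3 - 1)`. -/
theorem PowersAgree.edge_of_nonedges {m : ℕ} (hm : 2 ≤ m) (hgood : Δ.PowersAgree m) {x y z : V}
    (hxy : {x, y} ∉ Δ.faces) (hxz : {x, z} ∉ Δ.faces) : {y, z} ∈ Δ.faces := by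
  by_contra hyz
  have hcard : ({x, y, z} : Finset V).card = 3 :=
    card_eq_three.mpr ⟨x, y, z, ne_of_pair_notMem hxy, ne_of_pair_notMem hxz,
      ne_of_pair_notMem hyz, rfl⟩
  refine not_powersAgree_of_card (W := {x, y, z}) (s := 2) (d := 1)
    ⟨by simp, fun h => hxy (pairs_mem_of_triangle h).1⟩ (fun F hF => ?_)
    (fun A _ hA => hA.two_le_card) (by omega) (by omega) hgood
  by_contra! hlt
  obtain ⟨u, hu, v, hv, huv⟩ := one_lt_card.mp hlt
  rw [mem_inter] at hu hv
  have huvF : {u, v} ∈ Δ.faces :=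
    mem_faces_of_subset hF (by simp [insert_subset_iff, hu.1, hv.1]) (by simp)
  have hu' := hu.2
  have hv' := hv.2
  have hvuF : {v, u} ∈ Δ.faces := by rwa [pair_comm]
  simp only [mem_insert, mem_singleton] at hu' hv'
  rcases hu' with rfl | rfl | rfl <;> rcases hv' with rfl | rfl | rfl <;> first
    | exact huv rfl
    | exact hxy huvF
    | exact hxz huvF
    | exact hyz huvF
    | exact hxy hvuF
    | exact hxz hvuF
    | exact hyz hvuF

/-- If the `m`-th powers agree on at least five and at most `m + 3` vertices, then some two
vertices are not adjacent. -/
theorem PowersAgree.exists_nonedge (hdim : ∀ F ∈ Δ.faces, F.card ≤ 3) {m : ℕ}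
    (hcard : 5 ≤ Fintype.card V) (hm : Fintype.card V ≤ m + 3) (hgood : Δ.PowersAgree m) :
    ∃ i j : V, {i, j} ∉ Δ.faces := by
  by_contra! hall
  -- With `n` vertices the count needs `n < 3 * (n - 3)`, which holds from `n = 5` on.
  refine not_powersAgree_of_card (W := univ) (s := 3) (d := 3)
    ⟨card_pos.mp (by rw [card_univ]; omega), fun h => ?_⟩
    (fun F hF => (card_le_card inter_subset_left).trans (hdim F hF))
    (fun A _ hA => hA.three_le_card fun i _ j _ => hall i j) ?_ (by rwa [card_univ]) hgood
  · have := hdim _ h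
    rw [card_univ] at this
    omega
  · rw [card_univ]
    omega

theorem PowersAgree.exists_matching (hV : Fintype.card V = 6) (hdim : ∀ F ∈ Δ.faces, F.card ≤ 3)
    {m : ℕ} (hm : 3 ≤ m) (hgood : Δ.PowersAgree m) :
    ∃ u v w x y z, [u, v, w, x, y, z].Nodup ∧ {u, v} ∉ Δ.faces ∧ {w, x} ∉ Δ.faces ∧
      {y, z} ∉ Δ.faces := by
  by_contra hno
  obtain ⟨i, j, hij⟩ := hgood.exists_nonedge hdim (by omega) (by omega)
  exact hno (exists_matching_of_double_stars (N := fun x y => {x, y} ∉ Δ.faces) hV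
    (fun x y h => by rwa [pair_comm]) hij (ne_of_pair_notMem hij)
    fun i j _ h => (hgood.matching_or_double_star hV hdim hm h).resolve_left hno)

theorem eq_univ_of_disjoint_of_card {A B : Finset V} (hAB : Disjoint A B)
    (h : Fintype.card V ≤ A.card + B.card) (v : V) : v ∈ A ∨ v ∈ B := by
  have h1 : A ∪ B = univ := by
    rw [← card_eq_iff_eq_univ, card_union_of_disjoint hAB]
    refine le_antisymm ?_ h
    rw [← card_union_of_disjoint hAB]
    exact card_le_univ _
  rw [← mem_union, h1]
  exact mem_univ v

omit [Fintype V] in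
theorem exists_isTop_of_card_eq_two {C : Finset V} (hC : C.card = 2) (hCn : C ∉ Δ.faces)
    (a : V → ℕ) : ∃ x e, Δ.IsTop a C x e := by
  obtain ⟨x, y, -, rfl⟩ := card_eq_two.mp hC
  exact exists_isTop_pair a hCn

omit [Fintype V] in
theorem exists_isTop_of_card_eq_one {C : Finset V} (hC : C.card = 1)
    (a : V → ℕ) : ∃ x e, Δ.IsTop a C x e := by
  obtain ⟨x, rfl⟩ := card_eq_one.mp hC
  exact exists_isTop_singleton Δ a x

theorem powersAgree_of_card_eq_six (hV : Fintype.card V = 6) (hdim : ∀ F ∈ Δ.faces, F.card ≤ 3)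
    (hpure : Δ.InTriangles) {m : ℕ} (hm : 3 ≤ m) (hgood : Δ.PowersAgree m) (k : ℕ) :
    Δ.PowersAgree k := by
  obtain ⟨u, v, w, x, y, z, hnd, h₁, h₂, h₃⟩ := hgood.exists_matching hV hdim hm
  have huniv : ([u, v, w, x, y, z].toFinset : Finset V) = univ := by
    rw [← card_eq_iff_eq_univ, List.toFinset_card_of_nodup hnd, hV]
    rfl
  simp only [List.nodup_cons, List.mem_cons, List.not_mem_nil, not_or] at hnd
  refine powersAgree_of_three_classes hpure (fun a => exists_isTop_pair a h₁)
    (fun a => exists_isTop_pair a h₂) (fun a => exists_isTop_pair a h₃) (fun t => ?_) ?_ ?_ ?_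
    (fun _ _ _ => hgood.edge_of_nonedges (by omega)) k
  · have := mem_univ t
    rw [← huniv] at this
    simpa [or_assoc] using this
  all_goals
    simp only [disjoint_insert_left, disjoint_singleton_left, mem_insert, mem_singleton]
    tauto

/-- The all-ones vector must pack two nonfaces, by the pair obstruction at a nonedge. They are
disjoint of sizes 2 and 3, or 2 and 2 with one vertex left as a class of its own. -/
theorem powersAgree_of_card_eq_five (hV : Fintype.card V = 5) (hdim : ∀ F ∈ Δ.faces, F.card ≤ 3)
    (hpure : Δ.InTriangles) {m : ℕ} (hm : 2 ≤ m) (hgood : Δ.PowersAgree m) (k : ℕ) :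
    Δ.PowersAgree k := by
  obtain ⟨i, j, hij⟩ := hgood.exists_nonedge hdim (by omega) (by omega)
  have hτ : Δ.DegGE 2 (fun v => if v ∈ (univ : Finset V) then 1 else 0) :=
    degGE_indicator (d := 3) (fun F hF => (card_le_card inter_subset_left).trans (hdim F hF))
      (by rw [card_univ, hV])
  have hp : Δ.Packs 2 (fun v => if v ∈ (univ : Finset V) then 1 else 0) := by
    by_contra hp
    exact not_powersAgree_of_pair hτ hp hij (by simp) (by simp) hm hgood
  obtain ⟨M, hM, hM', hMa⟩ := hp
  obtain ⟨A, B, rfl⟩ := Multiset.card_eq_two.mp hM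
  have hA := hM' A (by simp)
  have hB := hM' B (by simp)
  have hAB : Disjoint A B := by
    rw [disjoint_left]
    intro v hvA hvB
    have := hMa v
    simp [Multiset.insert_eq_cons, ← Multiset.cons_zero, hvA, hvB] at this
  clear hM hM' hMa hτ
  have hcard : A.card + B.card ≤ 5 := by
    rw [← card_union_of_disjoint hAB, ← hV]
    exact card_le_univ _
  wlog hle : A.card ≤ B.card generalizing A B
  · exact this B A hB hA hAB.symm (by omega) (by omega)
  have hA2 := hA.two_le_card
  have hB2 := hB.two_le_card
  have hAc : A.card = 2 := by omega
  by_cases hBc : B.card = 3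
  · exact powersAgree_of_class_of_triple hpure (exists_isTop_of_card_eq_two hAc hA.2) hBc hB.2 hAB
      (eq_univ_of_disjoint_of_card hAB (by omega)) k
  · have hBc' : B.card = 2 := by omega
    have hC : (A ∪ B)ᶜ.card = 1 := by
      rw [card_compl, card_union_of_disjoint hAB]
      omega
    refine powersAgree_of_three_classes hpure (exists_isTop_of_card_eq_two hAc hA.2)
      (exists_isTop_of_card_eq_two hBc' hB.2) (exists_isTop_of_card_eq_one hC) (fun v => ?_) hAB
      ?_ ?_ (fun _ _ _ => hgood.edge_of_nonedges hm) k
    · simp only [mem_compl, mem_union]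
      tauto
    · exact disjoint_compl_right.mono_left subset_union_left
    · exact disjoint_compl_right.mono_left subset_union_right

theorem powersAgree_of_card_eq_four (hV : Fintype.card V = 4) (hdim : ∀ F ∈ Δ.faces, F.card ≤ 3)
    (hpure : Δ.InTriangles) (k : ℕ) : Δ.PowersAgree k := by
  by_cases hS : ∃ S : Finset V, S.card = 3 ∧ S ∉ Δ.faces
  · obtain ⟨S, hS, hSn⟩ := hS
    have hC : Sᶜ.card = 1 := by
      rw [card_compl]
      omega
    exact powersAgree_of_class_of_triple hpure (exists_isTop_of_card_eq_one hC) hS hSn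
      disjoint_compl_left (fun v => by rw [mem_compl]; tauto) k
  -- Here `Δ` is the boundary of a tetrahedron, and copies of the full vertex set suffice.
  · push Not at hS
    intro a ha
    have huniv : Δ.IsNonface univ := by
      refine ⟨card_pos.mp (by rw [card_univ]; omega), fun h => ?_⟩
      have := hdim _ h
      rw [card_univ] at this
      omega
    refine (huniv.packs k).mono fun v => ?_
    have h1 := ha _ (hS (univ.erase v) (by rw [card_erase_of_mem (mem_univ v), card_univ]; omega))
    have h2 := add_sum_erase univ a (mem_univ v)
    simp only [mem_univ, if_true]
    omega

theorem powersAgree_of_card_le_three [Nonempty V] (hV : Fintype.card V ≤ 3)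
    (hpure : Δ.InTriangles) (k : ℕ) : Δ.PowersAgree k := by
  intro a ha
  obtain ⟨T, hT, -, hT3⟩ := hpure _ (Δ.singleton_mem (Classical.arbitrary V))
  -- `Δ` is a full triangle, so the degree condition forces `k = 0`.
  obtain rfl : T = univ := eq_univ_of_card _ (le_antisymm (card_le_univ T) (by omega))
  have := ha _ hT
  exact (packs_zero a).of_le (by omega)

theorem powersAgree_of_four_le [Nonempty V] (hdim : ∀ F ∈ Δ.faces, F.card ≤ 3)
    (hpure : Δ.InTriangles) {m : ℕ} (hm : 4 ≤ m) (hgood : Δ.PowersAgree m) (k : ℕ) :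
    Δ.PowersAgree k := by
  have h6 := hgood.card_le_six hdim hm
  by_cases h3 : Fintype.card V ≤ 3
  · exact powersAgree_of_card_le_three h3 hpure k
  obtain hV | hV | hV : Fintype.card V = 4 ∨ Fintype.card V = 5 ∨ Fintype.card V = 6 := by omega
  · exact powersAgree_of_card_eq_four hV hdim hpure k
  · exact powersAgree_of_card_eq_five hV hdim hpure (by omega) hgood k
  · exact powersAgree_of_card_eq_six hV hdim hpure (by omega) hgood k

theorem PowersAgree.of_le [Nonempty V] (hdim : ∀ F ∈ Δ.faces, F.card ≤ 3)
    (hpure : Δ.InTriangles) {m : ℕ} (hm : 3 ≤ m) (hgood : Δ.PowersAgree m) {k : ℕ} (hk : k ≤ m) :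
    Δ.PowersAgree k := by
  by_cases hm4 : 4 ≤ m
  · exact powersAgree_of_four_le hdim hpure hm4 hgood k
  obtain rfl : m = 3 := by omega
  obtain rfl | rfl | rfl | rfl : k = 0 ∨ k = 1 ∨ k = 2 ∨ k = 3 := by omega
  exacts [powersAgree_zero, powersAgree_one, hgood.two_of_three hdim, hgood]

omit [DecidableEq V] in
theorem inTriangles_of_isPure (hpure : Δ.IsPure) (hdim : Δ.HasDim 2) : Δ.InTriangles := by
  intro F hF
  obtain ⟨T, hT, hFT⟩ := exists_isFacet_of_mem hF
  obtain ⟨⟨G, hG, hG3⟩, hle⟩ := hdim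
  obtain ⟨U, hU, hGU⟩ := exists_isFacet_of_mem hG
  have h1 := card_le_card hGU
  have h2 := hle U hU.1
  exact ⟨T, hT.1, hFT, by rw [hpure T U hT hU]; omega⟩

end AbstractSimplicialComplex

theorem mainTheorem5 (K : Type*) [Field K] (n : ℕ) (Δ : AbstractSimplicialComplex (Fin n))
    (hpure : Δ.IsPure) (hdim : Δ.HasDim 2) :
    (∀ m : ℕ, 3 ≤ m →
      (Δ.stanleyReisnerIdeal K).symbolicPower m = Δ.stanleyReisnerIdeal K ^ m →
      ∀ k : ℕ, k ≤ m →
        (Δ.stanleyReisnerIdeal K).symbolicPower k = Δ.stanleyReisnerIdeal K ^ k) ∧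
    ((∃ m : ℕ, 4 ≤ m ∧
        (Δ.stanleyReisnerIdeal K).symbolicPower m = Δ.stanleyReisnerIdeal K ^ m) →
      ∀ k : ℕ, 1 ≤ k →
        (Δ.stanleyReisnerIdeal K).symbolicPower k = Δ.stanleyReisnerIdeal K ^ k) := by
  obtain ⟨F, hF, hF3⟩ := hdim.1
  obtain ⟨v, -⟩ := Finset.card_pos.mp (by omega : 0 < F.card)
  have : Nonempty (Fin n) := ⟨v⟩
  have htri := AbstractSimplicialComplex.inTriangles_of_isPure hpure hdim
  simp only [AbstractSimplicialComplex.symbolicPower_eq_pow_iff]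
  refine ⟨fun m hm h k hk => h.of_le hdim.2 htri hm hk, ?_⟩
  rintro ⟨m, hm, h⟩ k -
  exact AbstractSimplicialComplex.powersAgree_of_four_le hdim.2 htri hm h k
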